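/- Let $K$ be a field and let $S=\bigoplus_{n\ge 0}S_n$ be a standard graded $K$-algebra, i.e. $S_0=K$, $S=K[S_1]$ and $S$ is finitely generated over $K$. Let $M=\bigoplus_{n\ge 0}M_n$ be a finitely generated graded $S$-module of Krull dimension $m\ge 0$ (in particular $M\neq 0$). Put $H(M,n)=\dim_K M_n$, $H_0(M,n)=H(M,n)$ and $H_i(M,n)=\sum_{j=0}^{n}H_{i-1}(M,j)$ for $i\ge 1$. Fix an integer $i\ge 0$. Then there is a unique polynomial $$P_i(M,n)=\sum_{k=0}^{m+i-1}d^i_{M,k}\,n^k\in\mathbb Q[n]$$ with $H_i(M,n)=P_i(M,n)$ for all $n\gg 0$. Let $\alpha^i(M)$ be the least $n_0\in\mathbb N$ such that $H_i(M,n)=P_i(M,n)$ for all $n\ge n_0$, and put $$\theta^i_M(z,w)=\sum_{n=0}^{\alpha^i(M)-1}\frac{H_i(M,n)}{(n+w)^z},\qquad \theta^i_M(z)=\sum_{n=1}^{\alpha^i(M)-1}\frac{H_i(M,n)}{n^z}.$$ For $w>0$ let $\zeta^i_M(z,w)$ be the meromorphic continuation to $\mathbb C$ of $\sum_{n\ge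 0}H_i(M,n)(n+w)^{-z}$ (the series converges for $\operatorname{Re} z>m+i$), and let $\zeta^i_M(z)=\lim_{w\searrow 0}\bigl(\zeta^i_M(z,w)-H(M,0)w^{-z}\bigr)$. Let $\zeta(z,a)$, $a>0$, denote the Hurwitz zeta function, the continuation of $\sum_{n\ge 0}(n+a)^{-z}$. (1) For every $w>0$, and all $z\in\mathbb C\setminus\{1,\ldots,m+i\}$, $$\zeta^i_M(z,w)=\theta^i_M(z,w)+\sum_{k=0}^{m+i-1}d^i_{M,k}\sum_{\ell=0}^{k}\binom{k}{\ell}(-w)^{\ell}\,\zeta\bigl(z-k+\ell,\ \alpha^i(M)+w\bigr).$$ The function $z\mapsto\zeta^i_M(z,w)$ is meromorphic on $\mathbb C$, its poles lie in $\{1,2,\ldots,m+i\}$ and are simple, and $$\operatorname{Res}_{z=k+1}\zeta^i_M(z,w)=\sum_{\ell=k}^{m+i-1}\binom{\ell}{k}(-w)^{\ell-k}d^i_{M,\ell},\qquad 0\le k\le m+i-1.$$ (2) For all $z\in\mathbb C\setminus\{1,\ldots,m+i\}$ the limit defining $\zeta^i_M(z)$ exists and $$\zeta^i_M(z)=\theta^i_M(z)+\sum_{k=0}^{m+i-1}d^i_{M,k}\,\zeta\bigl(z-k,\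 \max\{\alpha^i(M),1\}\bigr).$$ The function $\zeta^i_M(z)$ is meromorphic on $\mathbb C$, its poles lie in $\{1,2,\ldots,m+i\}$ and are simple, and $$\operatorname{Res}_{z=k+1}\zeta^i_M(z)=d^i_{M,k},\qquad 0\le k\le m+i-1.$$ (In both parts the residue is understood as $0$ where the function is analytic.) -/

import Mathlib

open Filter Topology

noncomputable section

/-! ### Standard graded algebras -/

/-- `S = ⨁ 𝒮 n` is a standard graded `K`-algebra: `𝒮 0 = K` (the map `K → S` is injective with
image `𝒮 0`), `S` is generated over `K` by its elements of degree one, and it is finitely generated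
as a `K`-algebra. -/
structure IsStandardGraded {K S : Type*} [Field K] [CommRing S] [Algebra K S]
    (𝒮 : ℕ → Submodule K S) : Prop where
  injective : Function.Injective (algebraMap K S)
  degree_zero : 𝒮 0 = LinearMap.range (Algebra.linearMap K S)
  generated : Algebra.adjoin K (𝒮 1 : Set S) = ⊤
  finiteType : Algebra.FiniteType K S

/-! ### Meromorphic continuation of a series of functions -/

/-- `F` is the meromorphic continuation to `ℂ` of the series `∑ f n z`: it is meromorphic on `ℂ`,
its value at every point that is not a pole is the analytic one (and it is `0` at the poles),
and on some right half-plane the series converges to it. There is at most one such `F`, by the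
identity theorem. -/
def IsMeromorphicContinuation (f : ℕ → ℂ → ℂ) (F : ℂ → ℂ) : Prop :=
  MeromorphicNFOn F Set.univ ∧
    ∃ σ : ℝ, ∀ z : ℂ, σ < z.re → HasSum (fun n => f n z) (F z)

open Classical in
/-- The meromorphic continuation to `ℂ` of the series `∑ f n z` (zero if there is none). -/
def meromorphicContinuation (f : ℕ → ℂ → ℂ) : ℂ → ℂ :=
  if h : ∃ F, IsMeromorphicContinuation f F then h.choose else 0

/-- Near `p` one has `F z = R / (z - p) + g z` with `g` analytic at `p`: the function `F` is
meromorphic at `p`, has there at most a simple pole, and its residue at `p` is `R`. -/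
def HasAtMostSimplePole (F : ℂ → ℂ) (p R : ℂ) : Prop :=
  ∃ g : ℂ → ℂ, AnalyticAt ℂ g p ∧ ∀ᶠ z in 𝓝[≠] p, F z = R / (z - p) + g z

/-- The set `{1, 2, …, N}` in `ℂ`. -/
def onePoleSet (N : ℕ) : Set ℂ := {z | ∃ k : ℕ, 1 ≤ k ∧ k ≤ N ∧ z = k}

/-! ### The Hurwitz zeta function with an arbitrary parameter `a > 0` -/

/-- The Hurwitz zeta function `ζ(s, a)`, the continuation of `∑ 1 / (n + a) ^ s`, for every real
`a > 0`. The function of Mathlib treats the parameters in `(0, 1]`; here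
`a = b + N` with `b ∈ (0, 1]` and `N = ⌈a⌉ - 1`, and the first `N` terms are removed. -/
def hurwitz (s : ℂ) (a : ℝ) : ℂ :=
  HurwitzZeta.hurwitzZeta (a : UnitAddCircle) s -
    ∑ n ∈ Finset.range (⌈a⌉₊ - 1),
      1 / ((n : ℂ) + ((a - ((⌈a⌉₊ - 1 : ℕ) : ℝ) : ℝ) : ℂ)) ^ s

theorem hasSum_hurwitz {a : ℝ} (ha : 0 < a) {s : ℂ} (hs : 1 < s.re) :
    HasSum (fun n : ℕ => 1 / ((n : ℂ) + (a : ℂ)) ^ s) (hurwitz s a) := by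
  have h1 : 1 ≤ ⌈a⌉₊ := Nat.one_le_iff_ne_zero.mpr (Nat.ceil_pos.mpr ha).ne'
  obtain ⟨N, hN⟩ : ∃ N : ℕ, ⌈a⌉₊ = N + 1 := ⟨⌈a⌉₊ - 1, by omega⟩
  have hup : a ≤ (N : ℝ) + 1 := by
    have := Nat.le_ceil a
    rw [hN] at this
    exact_mod_cast this
  have hlo : (N : ℝ) < a := by
    have := (Nat.lt_ceil (n := N) (a := a)).mp (by omega)
    exact this
  have hcoe : ((a - (N : ℝ) : ℝ) : UnitAddCircle) = (a : UnitAddCircle) := by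
    have hN0 : ((N : ℝ) : UnitAddCircle) = 0 := by
      rw [AddCircle.coe_eq_zero_iff]
      exact ⟨N, by simp⟩
    rw [AddCircle.coe_sub, hN0, sub_zero]
  have hb := HurwitzZeta.hasSum_hurwitzZeta_of_one_lt_re (a := a - N)
    ⟨by linarith, by linarith⟩ hs
  rw [hcoe] at hb
  have hb' := (hasSum_nat_add_iff' N).mpr hb
  have hlast : ⌈a⌉₊ - 1 = N := by omega
  unfold hurwitz
  rw [hlast]
  refine hb'.congr_fun ?_
  intro n
  push_cast
  ring_nf

theorem differentiableAt_hurwitz {a : ℝ} (ha : 0 < a) {s : ℂ} (hs : s ≠ 1) :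
    DifferentiableAt ℂ (fun s => hurwitz s a) s := by
  have hup := (Nat.lt_ceil (n := ⌈a⌉₊ - 1) (a := a)).mp
    (by have := Nat.ceil_pos.mpr ha; omega)
  unfold hurwitz
  refine (HurwitzZeta.differentiableAt_hurwitzZeta _ hs).sub (DifferentiableAt.fun_sum ?_)
  intro n _
  have hpos : ((n : ℂ) + ((a - ((⌈a⌉₊ - 1 : ℕ) : ℝ) : ℝ) : ℂ)) ≠ 0 := by
    have : (0 : ℝ) < (n : ℝ) + (a - ((⌈a⌉₊ - 1 : ℕ) : ℝ)) := by
      have := Nat.cast_nonneg (α := ℝ) n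
      linarith
    exact_mod_cast this.ne'
  refine DifferentiableAt.div (differentiableAt_const _) ?_ ?_
  · exact DifferentiableAt.const_cpow differentiableAt_id (Or.inl hpos)
  · rw [Ne, Complex.cpow_eq_zero_iff]
    exact fun h => hpos h.1

/-! ### Hilbert functions and the associated zeta functions -/

section Zeta

variable {K M : Type*} [Field K] [AddCommGroup M] [Module K M] (ℳ : ℕ → Submodule K M)

/-- The Hilbert function `H(M, n) = dim_K M_n`. -/
def hilbertFunction (n : ℕ) : ℕ := Module.finrank K (ℳ n)

/-- The higher iterated Hilbert functions: `H_0(M, n) = H(M, n)` and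
`H_{i+1}(M, n) = ∑_{j = 0}^n H_i(M, j)`. -/
def iteratedHilbert : ℕ → ℕ → ℕ
  | 0, n => hilbertFunction ℳ n
  | i + 1, n => ∑ j ∈ Finset.range (n + 1), iteratedHilbert i j

open Classical in
/-- The polynomial `P_i(M, ·)` with `H_i(M, n) = P_i(M, n)` for all large `n`. Such a polynomial is
unique if it exists (and the definition gives `0` if there is none). -/
def hilbertPolynomial (i : ℕ) : Polynomial ℚ :=
  if h : ∃ P : Polynomial ℚ, ∀ᶠ n : ℕ in atTop, (iteratedHilbert ℳ i n : ℚ) = P.eval (n : ℚ)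
  then h.choose else 0

/-- The coefficient `d^i_{M,k}` of `n ^ k` in `P_i(M, n)`, as a complex number. -/
def hilbertCoeff (i k : ℕ) : ℂ := ((hilbertPolynomial ℳ i).coeff k : ℂ)

/-- `α^i(M)`, the least `n₀` with `H_i(M, n) = P_i(M, n)` for all `n ≥ n₀`. -/
def hilbertAlpha (i : ℕ) : ℕ :=
  sInf {n₀ : ℕ | ∀ n : ℕ, n₀ ≤ n →
    (iteratedHilbert ℳ i n : ℚ) = (hilbertPolynomial ℳ i).eval (n : ℚ)}

/-- `θ^i_M(z, w) = ∑_{n = 0}^{α^i(M) - 1} H_i(M, n) / (n + w) ^ z`. -/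
def higherThetaBarnes (i : ℕ) (w : ℝ) (z : ℂ) : ℂ :=
  ∑ n ∈ Finset.range (hilbertAlpha ℳ i), (iteratedHilbert ℳ i n : ℂ) / ((n : ℂ) + (w : ℂ)) ^ z

/-- `θ^i_M(z) = ∑_{n = 1}^{α^i(M) - 1} H_i(M, n) / n ^ z`. -/
def higherTheta (i : ℕ) (z : ℂ) : ℂ :=
  ∑ n ∈ Finset.Ico 1 (hilbertAlpha ℳ i), (iteratedHilbert ℳ i n : ℂ) / (n : ℂ) ^ z

/-- The higher Zeta-Barnes type function `ζ^i_M(z, w) = ∑_{n ≥ 0} H_i(M, n) / (n + w) ^ z`,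
continued meromorphically to `ℂ`. -/
def higherZetaBarnes (i : ℕ) (w : ℝ) : ℂ → ℂ :=
  meromorphicContinuation fun n z => (iteratedHilbert ℳ i n : ℂ) / ((n : ℂ) + (w : ℂ)) ^ z

/-- `ζ^i_M(z) = lim_{w ↘ 0} (ζ^i_M(z, w) - H(M, 0) w ^ (-z))`. -/
def higherZeta (i : ℕ) (z : ℂ) : ℂ :=
  limUnder (𝓝[>] (0 : ℝ)) fun w : ℝ =>
    higherZetaBarnes ℳ i w z - (hilbertFunction ℳ 0 : ℂ) * (w : ℂ) ^ (-z)

end Zeta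

end

noncomputable section

/-! ### Holomorphy of parametric integrals -/

/-! The theorem joins an algebraic fact, that `H_i(M, n)` is eventually a polynomial of degree less
than `N = m + i`, to an analytic study of `∑ H n (n + w)^(-z)` for any eventually polynomial `H`.

Analysis. Beyond the cutoff, write `n^k = ((n + w) - w)^k` and expand: the tail becomes a finite
combination of Hurwitz zeta functions. This holds for `Re z > N` (`hasSum_polyZetaBarnes`), and the
identity theorem makes the explicit expression the continuation. Poles and residues come from the
simple pole of `ζ(s, a)` at `s = 1`, of residue `1`. As `w ↘ 0` only the term `n = 0` is singular,
and it is the one subtracted. The limit of the rest needs continuity of `a ↦ ζ(s, a)` for every `s ≠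
1`, also where the series diverges. It follows from `∂ζ(s, a)/∂a = -s ζ(s + 1, a)`: integrating in
`a` carries continuity one unit to the left in `s` (`continuousOn_hurwitzMul_exp`), with holomorphy
of parametric integrals and the identity theorem justifying the formula there.

Algebra. Dévissage by homogeneous associated primes reduces the Hilbert function of `M` to those of
`S/p` with `p` in the support. If a degree one element `x` lies outside `p`, it is a nonzerodivisor
on `S/p`, so the difference of the Hilbert function of `S/p` is that of `S/(p + (x))`, where all
primes have smaller coheight. Induction on coheight bounds the degree
(`IsStandardGraded.hilbertDegreeLT_of_coheight_le`), and each summation raises it by one. -/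

theorem differentiableOn_intervalIntegral_of_continuousOn {U : Set ℂ} (hU : IsOpen U)
    {Φ : ℂ → ℝ → ℂ} (hc : ContinuousOn (Function.uncurry Φ) (U ×ˢ Set.univ))
    (hd : ∀ v, DifferentiableOn ℂ (fun s => Φ s v) U) (a b : ℝ) :
    DifferentiableOn ℂ (fun s => ∫ v in a..b, Φ s v) U := by
  intro s₀ hs₀
  obtain ⟨R, hR, hball⟩ := Metric.isOpen_iff.mp hU s₀ hs₀
  -- Discs of radius `r` about points of the `r`-ball then stay in one compact ball inside `U`, on
  -- which `Φ` is bounded.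
  obtain ⟨r, hr, hrR⟩ : ∃ r, 0 < r ∧ 2 * r < R := ⟨R / 3, by positivity, by linarith⟩
  have hcont : ∀ s ∈ U, Continuous (Φ s) := fun s hs =>
    hc.comp_continuous (f := fun v : ℝ => (s, v)) (by fun_prop) fun v => ⟨hs, trivial⟩
  have hcl : Metric.closedBall s₀ (2 * r) ⊆ U :=
    (Metric.closedBall_subset_ball hrR).trans hball
  have hclr : ∀ s ∈ Metric.ball s₀ r, Metric.closedBall s r ⊆ Metric.closedBall s₀ (2 * r) := by
    intro s hs
    apply Metric.closedBall_subset_closedBall'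
    have := Metric.mem_ball.mp hs
    linarith
  obtain ⟨C, hC⟩ := ((isCompact_closedBall s₀ (2 * r)).prod
    (isCompact_uIcc (a := a) (b := b))).exists_bound_of_continuousOn
      (hc.mono (Set.prod_mono hcl (Set.subset_univ _)))
  have hballU : ∀ s ∈ Metric.ball s₀ r, s ∈ U := fun s hs =>
    hcl (hclr s hs (Metric.mem_closedBall_self hr.le))
  have hderiv : ∀ t, ∀ s ∈ Metric.ball s₀ r,
      HasDerivAt (fun s => Φ s t) (deriv (fun s => Φ s t) s) s := fun t s hs =>
    ((hd t).differentiableAt (hU.mem_nhds (hballU s hs))).hasDerivAt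
  have hs₀r : s₀ ∈ Metric.ball s₀ r := Metric.mem_ball_self hr
  have key := intervalIntegral.hasDerivAt_integral_of_dominated_loc_of_deriv_le
    (μ := MeasureTheory.volume) (a := a) (b := b) (F := Φ)
    (F' := fun s t => deriv (fun s => Φ s t) s) (x₀ := s₀) (bound := fun _ => C / r)
    (Metric.ball_mem_nhds s₀ hr) ?_ ((hcont s₀ hs₀).intervalIntegrable _ _) ?_ ?_
    (continuous_const.intervalIntegrable _ _) ?_
  · exact key.2.differentiableAt.differentiableWithinAt
  · filter_upwards [hU.mem_nhds hs₀] with s hs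
    exact (hcont s hs).aestronglyMeasurable
  -- Measurability of the derivative in `t`: it is the pointwise limit of difference quotients along
  -- `s₀ + 1/(n + 1)`, each continuous in `t`.
  · have hseq : Tendsto (fun n : ℕ => s₀ + ((1 / ((n : ℝ) + 1) : ℝ) : ℂ)) atTop (𝓝[≠] s₀) := by
      rw [tendsto_nhdsWithin_iff]
      refine ⟨?_, Eventually.of_forall fun n => ?_⟩
      · have := (Complex.continuous_ofReal.tendsto 0).comp
          (tendsto_one_div_add_atTop_nhds_zero_nat (𝕜 := ℝ))
        simpa using! this.const_add s₀
      · have h : ((1 / ((n : ℝ) + 1) : ℝ) : ℂ) ≠ 0 := by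
          rw [Complex.ofReal_ne_zero]; positivity
        simpa using! h
    obtain ⟨N, hN⟩ := (hseq.eventually
      (mem_nhdsWithin_of_mem_nhds (hU.mem_nhds hs₀))).exists_forall_of_atTop
    refine aestronglyMeasurable_of_tendsto_ae (u := atTop)
      (f := fun n t => slope (fun s => Φ s t) s₀ (s₀ + ((1 / (((n + N : ℕ) : ℝ) + 1) : ℝ) : ℂ)))
      (fun n => ?_) (Eventually.of_forall fun t => ?_)
    · refine Continuous.aestronglyMeasurable ?_
      simp only [slope_def_module]
      exact ((hcont _ (hN (n + N) (by omega))).sub (hcont s₀ hs₀)).const_smul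
        ((s₀ + ((1 / (((n + N : ℕ) : ℝ) + 1) : ℝ) : ℂ) - s₀)⁻¹ : ℂ)
    · exact ((hasDerivAt_iff_tendsto_slope.mp (hderiv t s₀ hs₀r)).comp hseq).comp
        (tendsto_add_atTop_nat N)
  -- Cauchy's estimate on the circle of radius `r` about `s` gives the bound `C / r`.
  · refine Eventually.of_forall fun t ht s hs => ?_
    refine Complex.norm_deriv_le_of_forall_mem_sphere_norm_le hr ?_ fun z hz => ?_
    · refine DifferentiableOn.diffContOnCl_ball (U := U) (hd t) ?_
      exact (hclr s hs).trans hcl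
    · exact hC (z, t) ⟨hclr s hs (Metric.sphere_subset_closedBall hz),
        Set.uIoc_subset_uIcc ht⟩
  · exact Eventually.of_forall fun t _ s hs => hderiv t s hs

/-! ### The Hurwitz zeta function near its pole -/

/-- The entire function `s ↦ (s - 1) ζ(s, a)`. -/
def hurwitzMul (a : ℝ) : ℂ → ℂ := Function.update (fun s => (s - 1) * hurwitz s a) 1 1

theorem hurwitzMul_of_ne {a : ℝ} {s : ℂ} (hs : s ≠ 1) :
    hurwitzMul a s = (s - 1) * hurwitz s a := Function.update_of_ne hs _ _

/-- The finitely many removed terms are entire in `s`, so the residue `1` is not affected. This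
justifies the value at `1` in `hurwitzMul`. -/
theorem tendsto_sub_one_mul_hurwitz {a : ℝ} (ha : 0 < a) :
    Tendsto (fun s => (s - 1) * hurwitz s a) (𝓝[≠] 1) (𝓝 1) := by
  have h1 := HurwitzZeta.hurwitzZeta_residue_one (a : UnitAddCircle)
  have hdiff : DifferentiableAt ℂ (fun s : ℂ => ∑ n ∈ Finset.range (⌈a⌉₊ - 1),
      1 / ((n : ℂ) + ((a - ((⌈a⌉₊ - 1 : ℕ) : ℝ) : ℝ) : ℂ)) ^ s) 1 := by
    have hup := (Nat.lt_ceil (n := ⌈a⌉₊ - 1) (a := a)).mp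
      (by have := Nat.ceil_pos.mpr ha; omega)
    refine DifferentiableAt.fun_sum fun n _ => ?_
    have hpos : ((n : ℂ) + ((a - ((⌈a⌉₊ - 1 : ℕ) : ℝ) : ℝ) : ℂ)) ≠ 0 := by
      have : (0 : ℝ) < (n : ℝ) + (a - ((⌈a⌉₊ - 1 : ℕ) : ℝ)) := by
        have := Nat.cast_nonneg (α := ℝ) n
        linarith
      exact_mod_cast this.ne'
    refine DifferentiableAt.div (differentiableAt_const _) ?_ ?_
    · exact DifferentiableAt.const_cpow differentiableAt_id (Or.inl hpos)
    · rw [Ne, Complex.cpow_eq_zero_iff]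
      exact fun h => hpos h.1
  have h2 : Tendsto (fun s : ℂ => (s - 1) * ∑ n ∈ Finset.range (⌈a⌉₊ - 1),
      1 / ((n : ℂ) + ((a - ((⌈a⌉₊ - 1 : ℕ) : ℝ) : ℝ) : ℂ)) ^ s) (𝓝[≠] 1) (𝓝 0) := by
    have h3 : ContinuousAt (fun s : ℂ => (s - 1) * ∑ n ∈ Finset.range (⌈a⌉₊ - 1),
      1 / ((n : ℂ) + ((a - ((⌈a⌉₊ - 1 : ℕ) : ℝ) : ℝ) : ℂ)) ^ s) 1 :=
      (continuousAt_id.sub continuousAt_const).mul hdiff.continuousAt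
    have h4 := h3.tendsto.mono_left (nhdsWithin_le_nhds (s := {1}ᶜ))
    simpa using! h4
  simpa [hurwitz, mul_sub] using! h1.sub h2

theorem differentiable_hurwitzMul {a : ℝ} (ha : 0 < a) : Differentiable ℂ (hurwitzMul a) := by
  have hd : ∀ s : ℂ, s ≠ 1 → DifferentiableAt ℂ (hurwitzMul a) s := fun s hs => by
    refine ((differentiableAt_id.sub_const 1).mul
      (differentiableAt_hurwitz ha hs)).congr_of_eventuallyEq ?_
    filter_upwards [isOpen_ne.mem_nhds hs] with t ht using hurwitzMul_of_ne ht
  intro s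
  rcases ne_or_eq s 1 with hs | rfl
  · exact hd s hs
  · refine (Complex.analyticAt_of_differentiable_on_punctured_nhds_of_continuousAt
      (eventually_nhdsWithin_of_forall fun t ht => hd t ht) ?_).differentiableAt
    exact continuousAt_update_same.mpr (tendsto_sub_one_mul_hurwitz ha)

/-- The regular part is the divided difference at `1` of the entire function `(s - 1) ζ(s, a)`,
which takes the value `1` there. -/
theorem exists_hurwitz_eq_add {a : ℝ} (ha : 0 < a) :
    ∃ g : ℂ → ℂ, Differentiable ℂ g ∧ ∀ s : ℂ, s ≠ 1 → hurwitz s a = 1 / (s - 1) + g s := by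
  refine ⟨dslope (hurwitzMul a) 1, ?_, fun s hs => ?_⟩
  · rw [← differentiableOn_univ, Complex.differentiableOn_dslope univ_mem, differentiableOn_univ]
    exact differentiable_hurwitzMul ha
  · have hs' : s - 1 ≠ 0 := sub_ne_zero.mpr hs
    have h1 : hurwitzMul a 1 = 1 := Function.update_self _ _ _
    rw [dslope_of_ne _ hs, slope_def_field, h1, hurwitzMul_of_ne hs]
    field_simp
    ring

/-! ### Continuity of the Hurwitz zeta function in its parameter -/

theorem norm_natCast_add_cpow {a : ℝ} (ha : 0 < a) (n : ℕ) (s : ℂ) :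
    ‖((n : ℂ) + (a : ℂ)) ^ s‖ = ((n : ℝ) + a) ^ s.re := by
  have : ((n : ℂ) + (a : ℂ)) = (((n : ℝ) + a : ℝ) : ℂ) := by push_cast; rfl
  rw [this, Complex.norm_cpow_eq_rpow_re_of_pos (by positivity)]

theorem summable_natCast_add_rpow {c : ℝ} (hc : 0 < c) {σ : ℝ} (hσ : 1 < σ) :
    Summable fun n : ℕ => ((n : ℝ) + c) ^ (-σ) := by
  refine ((Real.summable_one_div_nat_add_rpow c σ).mpr hσ).congr fun n => ?_
  rw [abs_of_pos (by positivity), Real.rpow_neg (by positivity), one_div]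

/-- Termwise differentiation, dominated on `(c, ∞)` by a convergent series. The derivative involves
`s + 1`, which later allows an induction towards smaller `Re s`. -/
theorem hasDerivAt_hurwitz {a : ℝ} (ha : 0 < a) {s : ℂ} (hs : 1 < s.re) :
    HasDerivAt (fun a : ℝ => hurwitz s a) (-s * hurwitz (s + 1) a) a := by
  obtain ⟨c, hc, hca⟩ := exists_between ha
  have hpos : ∀ (n : ℕ) (y : ℝ), y ∈ Set.Ioi c → 0 < (n : ℝ) + y := fun n y hy => by
    have : 0 < y := hc.trans hy
    positivity
  have hs1 : 1 < (s + 1).re := by simp; linarith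
  have hsum := hasDerivAt_tsum_of_isPreconnected (𝕜 := ℝ) (F := ℂ)
    (g := fun (n : ℕ) (y : ℝ) => 1 / ((n : ℂ) + (y : ℂ)) ^ s)
    (g' := fun (n : ℕ) (y : ℝ) => -s * (1 / ((n : ℂ) + (y : ℂ)) ^ (s + 1)))
    (u := fun n : ℕ => ‖s‖ * ((n : ℝ) + c) ^ (-(s + 1).re)) (t := Set.Ioi c) (y₀ := a) (y := a)
    ((summable_natCast_add_rpow hc hs1).mul_left _) isOpen_Ioi isPreconnected_Ioi
    ?_ ?_ hca (hasSum_hurwitz ha hs).summable hca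
  · rw [tsum_mul_left, (hasSum_hurwitz ha hs1).tsum_eq] at hsum
    refine hsum.congr_of_eventuallyEq ?_
    filter_upwards [Ioi_mem_nhds ha] with y hy
    exact (hasSum_hurwitz hy hs).tsum_eq.symm
  · intro n y hy
    have hne : (n : ℂ) + (y : ℂ) ≠ 0 := by exact_mod_cast (hpos n y hy).ne'
    have hslit : (n : ℂ) + (y : ℂ) ∈ Complex.slitPlane :=
      Or.inl (by simpa using hpos n y hy)
    have h1 : HasDerivAt (fun z : ℂ => ((n : ℂ) + z) ^ (-s)) _ (y : ℂ) :=
      ((hasDerivAt_id (y : ℂ)).const_add (n : ℂ)).cpow_const (c := -s) hslit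
    have e1 : (fun y : ℝ => 1 / ((n : ℂ) + (y : ℂ)) ^ s)
        = fun y : ℝ => ((n : ℂ) + (y : ℂ)) ^ (-s) := by
      ext y; simp [Complex.cpow_neg]
    rw [e1]
    convert! h1.comp_ofReal using 1
    rw [show -s - 1 = -(s + 1) by ring, Complex.cpow_neg, one_div, mul_one]
    rfl
  · intro n y hy
    have hy' : c < y := hy
    rw [norm_mul, norm_neg, norm_div, norm_one, norm_natCast_add_cpow (hc.trans hy'),
      one_div, ← Real.rpow_neg (hpos n y hy).le]
    refine mul_le_mul_of_nonneg_left ?_ (norm_nonneg _)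
    exact Real.rpow_le_rpow_of_nonpos (by positivity) (by linarith) (by linarith)

theorem continuousAt_uncurry_hurwitz {a : ℝ} (ha : 0 < a) {s : ℂ} (hs : 1 < s.re) :
    ContinuousAt (fun p : ℂ × ℝ => hurwitz p.1 p.2) (s, a) := by
  obtain ⟨c, hc, hca⟩ := exists_between ha
  obtain ⟨σ, hσ, hσs⟩ := exists_between hs
  obtain ⟨τ, hτ⟩ := exists_gt s.re
  have hστ : 1 < τ := hs.trans hτ
  set W : Set (ℂ × ℝ) := {p | (σ < p.1.re ∧ p.1.re < τ) ∧ c < p.2} with hW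
  have hre : Continuous fun p : ℂ × ℝ => p.1.re := by fun_prop
  have hWo : IsOpen W := ((isOpen_lt continuous_const hre).inter
    (isOpen_lt hre continuous_const)).inter (isOpen_lt continuous_const continuous_snd)
  have hpos : ∀ (n : ℕ) (p : ℂ × ℝ), p ∈ W → 0 < (n : ℝ) + p.2 := fun n p hp => by
    have : 0 < p.2 := hc.trans hp.2
    positivity
  have hne : ∀ (n : ℕ) (p : ℂ × ℝ), p ∈ W → (n : ℂ) + (p.2 : ℂ) ≠ 0 := fun n p hp => by
    exact_mod_cast (hpos n p hp).ne'
  have hcont : ContinuousOn (fun p : ℂ × ℝ => ∑' n : ℕ, 1 / ((n : ℂ) + (p.2 : ℂ)) ^ p.1) W := by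
    -- The base `n + c` may lie on either side of `1`, so the extreme power is at `σ` or at `τ`; the
    -- sum of both dominates in either case.
    refine continuousOn_tsum (u := fun n : ℕ => ((n : ℝ) + c) ^ (-σ) + ((n : ℝ) + c) ^ (-τ))
      (fun n => ?_) ((summable_natCast_add_rpow hc hσ).add (summable_natCast_add_rpow hc hστ)) ?_
    · refine continuousOn_const.div (ContinuousOn.cpow (by fun_prop) (by fun_prop) ?_) ?_
      · intro p hp
        exact Or.inl (by simpa using hpos n p hp)
      · intro p hp
        rw [Ne, Complex.cpow_eq_zero_iff]
        exact fun h => hne n p hp h.1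
    · intro n p hp
      have hp2 : c < p.2 := hp.2
      have hnc : 0 < (n : ℝ) + c := by positivity
      rw [norm_div, norm_one, norm_natCast_add_cpow (hc.trans hp2), one_div,
        ← Real.rpow_neg (hpos n p hp).le]
      have h1 : ((n : ℝ) + p.2) ^ (-p.1.re) ≤ ((n : ℝ) + c) ^ (-p.1.re) :=
        Real.rpow_le_rpow_of_nonpos hnc (by linarith) (by linarith [hp.1.1])
      refine h1.trans ?_
      rcases le_total 1 ((n : ℝ) + c) with h | h
      · refine le_add_of_le_of_nonneg ?_ (by positivity)
        exact Real.rpow_le_rpow_of_exponent_le h (by linarith [hp.1.1])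
      · refine le_add_of_nonneg_of_le (by positivity) ?_
        exact Real.rpow_le_rpow_of_exponent_ge hnc h (by linarith [hp.1.2])
  refine (hcont.continuousAt (hWo.mem_nhds ⟨⟨hσs, hτ⟩, hca⟩)).congr ?_
  filter_upwards [hWo.mem_nhds (show (s, a) ∈ W from ⟨⟨hσs, hτ⟩, hca⟩)] with p hp
  exact (hasSum_hurwitz (hc.trans hp.2) (hσ.trans hp.1.1)).tsum_eq

/-- Induction over the half-planes `Re s > 1 - N`. The factor `s - 1` clears the pole, and `a = e^u`
lets the parameter range over all of `ℝ`. Integrating the derivative in `u` expresses the value at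
`s` through values at `s + 1`, where continuity is already known. -/
theorem continuousOn_hurwitzMul_exp (N : ℕ) :
    ContinuousOn (fun p : ℂ × ℝ => hurwitzMul (Real.exp p.2) p.1)
      ({s : ℂ | 1 - (N : ℝ) < s.re} ×ˢ Set.univ) := by
  induction N with
  | zero =>
    rintro ⟨s, u⟩ ⟨hs, -⟩
    have hs' : 1 < s.re := by simpa using hs
    have h1 : ContinuousAt (fun p : ℂ × ℝ => (p.1 - 1) * hurwitz p.1 (Real.exp p.2)) (s, u) :=
      (by fun_prop : ContinuousAt (fun p : ℂ × ℝ => p.1 - 1) (s, u)).mul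
        (ContinuousAt.comp (x := ((s, u) : ℂ × ℝ)) (f := fun p : ℂ × ℝ => (p.1, Real.exp p.2))
          (continuousAt_uncurry_hurwitz (Real.exp_pos u) hs') (by fun_prop))
    refine (h1.congr ?_).continuousWithinAt
    have : ∀ᶠ p : ℂ × ℝ in 𝓝 (s, u), 1 < p.1.re :=
      (isOpen_lt continuous_const (by fun_prop)).mem_nhds hs'
    filter_upwards [this] with p hp
    refine (hurwitzMul_of_ne ?_).symm
    intro h
    simp [h] at hp
  | succ N ih =>
    set U : Set ℂ := {s : ℂ | 1 - ((N + 1 : ℕ) : ℝ) < s.re} with hU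
    have hUo : IsOpen U := isOpen_lt continuous_const Complex.continuous_re
    have hUconv : Convex ℝ U := convex_halfSpace_re_gt _
    -- The factor `s = (s + 1) - 1` from the derivative is exactly what clears the pole of `ζ(s + 1,
    -- ·)`.
    set Φ : ℂ → ℝ → ℂ := fun s v => hurwitzMul (Real.exp v) (s + 1) * (Real.exp v : ℂ) with hΦ
    have hΦc : ContinuousOn (Function.uncurry Φ) (U ×ˢ Set.univ) := by
      refine ContinuousOn.mul (ih.comp (f := fun p : ℂ × ℝ => (p.1 + 1, p.2)) (by fun_prop) ?_)
        (by fun_prop)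
      rintro ⟨s, v⟩ ⟨hs, -⟩
      refine ⟨?_, trivial⟩
      simp only [hU, Set.mem_ofPred_eq, Nat.cast_add, Nat.cast_one, Complex.add_re,
        Complex.one_re] at hs ⊢
      linarith
    have hΦd : ∀ v, DifferentiableOn ℂ (fun s => Φ s v) U := fun v =>
      (((differentiable_hurwitzMul (Real.exp_pos v)).comp
        (differentiable_id.add_const 1)).mul_const _).differentiableOn
    set G : ℂ → ℝ → ℂ := fun s u => hurwitzMul (Real.exp 0) s - (s - 1) * ∫ v in (0 : ℝ)..u, Φ s v
      with hG
    -- Both sides are holomorphic on the convex set `U`; near `s = 2` the identity is the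
    -- fundamental theorem of calculus, and the identity theorem spreads it.
    have hEq : ∀ u : ℝ, Set.EqOn (hurwitzMul (Real.exp u)) (fun s => G s u) U := by
      intro u
      have hGd : DifferentiableOn ℂ (fun s => G s u) U :=
        (differentiable_hurwitzMul (Real.exp_pos 0)).differentiableOn.sub
          ((differentiableOn_id.sub_const 1).mul
            (differentiableOn_intervalIntegral_of_continuousOn hUo hΦc hΦd 0 u))
      have h2U : (2 : ℂ) ∈ U := by
        simp only [hU, Set.mem_ofPred_eq, Nat.cast_add, Nat.cast_one, Complex.re_ofNat]
        have := Nat.cast_nonneg (α := ℝ) N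
        linarith
      refine AnalyticOnNhd.eqOn_of_preconnected_of_eventuallyEq
        ((differentiable_hurwitzMul (Real.exp_pos u)).differentiableOn.analyticOnNhd hUo)
        (hGd.analyticOnNhd hUo) hUconv.isPreconnected h2U ?_
      have hre : ∀ᶠ s : ℂ in 𝓝 2, 1 < s.re :=
        (isOpen_lt continuous_const Complex.continuous_re).mem_nhds (by simp)
      filter_upwards [hre, hUo.mem_nhds h2U] with s hs hsU
      have hs1 : s ≠ 1 := by rintro rfl; simp at hs
      have hs1' : s + 1 ≠ 1 := by
        intro h
        have : s = 0 := by simpa using h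
        simp [this] at hs
        linarith
      have hderiv : ∀ v ∈ Set.uIcc 0 u,
          HasDerivAt (fun v : ℝ => hurwitz s (Real.exp v)) (-Φ s v) v := by
        intro v _
        have h := (hasDerivAt_hurwitz (Real.exp_pos v) hs).scomp v (Real.hasDerivAt_exp v)
        convert! h using 1
        rw [hΦ, Complex.real_smul]
        simp only [hurwitzMul_of_ne hs1']
        ring
      have hint := intervalIntegral.integral_eq_sub_of_hasDerivAt hderiv
        ((hΦc.comp_continuous (f := fun v : ℝ => (s, v)) (by fun_prop)
          fun v => ⟨hsU, trivial⟩).neg.intervalIntegrable 0 u)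
      rw [intervalIntegral.integral_neg] at hint
      simp only [hG, hurwitzMul_of_ne hs1]
      linear_combination -(s - 1) * hint
    have hGc : ContinuousOn (fun p : ℂ × ℝ => G p.1 p.2) (U ×ˢ Set.univ) := by
      refine ContinuousOn.sub ?_ (ContinuousOn.mul (by fun_prop) ?_)
      · exact ((differentiable_hurwitzMul (Real.exp_pos 0)).continuous.comp
          continuous_fst).continuousOn
      · rw [continuousOn_iff_continuous_domRestrict]
        refine intervalIntegral.continuous_parametric_intervalIntegral_of_continuous
          (X := (U ×ˢ Set.univ : Set (ℂ × ℝ))) (f := fun x v => Φ x.1.1 v)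
          (s := fun x => x.1.2) ?_ (by fun_prop)
        exact hΦc.comp_continuous (f := fun q : (U ×ˢ Set.univ : Set (ℂ × ℝ)) × ℝ => (q.1.1.1, q.2))
          (by fun_prop) fun q => ⟨q.1.2.1, trivial⟩
    exact hGc.congr fun p hp => hEq p.2 hp.1

theorem continuousAt_hurwitz_param {a : ℝ} (ha : 0 < a) {s : ℂ} (hs : s ≠ 1) :
    ContinuousAt (fun a : ℝ => hurwitz s a) a := by
  obtain ⟨N, hN⟩ := exists_nat_gt (1 - s.re)
  have h1 : ContinuousAt (fun u : ℝ => hurwitzMul (Real.exp u) s) (Real.log a) :=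
    ((continuousOn_hurwitzMul_exp N).comp_continuous (f := fun u : ℝ => (s, u)) (by fun_prop)
      fun u => ⟨by simp only [Set.mem_ofPred_eq]; linarith, trivial⟩).continuousAt
  have h2 : ContinuousAt (fun a : ℝ => (s - 1)⁻¹ * hurwitzMul (Real.exp (Real.log a)) s) a :=
    (ContinuousAt.comp (f := Real.log) h1 (Real.continuousAt_log ha.ne')).const_mul _
  refine h2.congr ?_
  filter_upwards [Ioi_mem_nhds ha] with b hb
  rw [Real.exp_log hb, hurwitzMul_of_ne hs, inv_mul_cancel_left₀ (sub_ne_zero.mpr hs)]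

/-! ### Functions with at most a simple pole -/

namespace HasAtMostSimplePole

theorem of_analyticAt {F : ℂ → ℂ} {p : ℂ} (h : AnalyticAt ℂ F p) : HasAtMostSimplePole F p 0 :=
  ⟨F, h, Eventually.of_forall fun z => by simp⟩

theorem congr {F G : ℂ → ℂ} {p R : ℂ} (h : HasAtMostSimplePole F p R) (hFG : G =ᶠ[𝓝[≠] p] F) :
    HasAtMostSimplePole G p R := by
  obtain ⟨g, hg, hF⟩ := h
  refine ⟨g, hg, ?_⟩
  filter_upwards [hF, hFG] with z h1 h2
  rw [h2, h1]

theorem add {F G : ℂ → ℂ} {p R R' : ℂ} (hF : HasAtMostSimplePole F p R)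
    (hG : HasAtMostSimplePole G p R') :
    HasAtMostSimplePole (fun z => F z + G z) p (R + R') := by
  obtain ⟨f, hf, hF⟩ := hF
  obtain ⟨g, hg, hG⟩ := hG
  refine ⟨_, hf.add hg, ?_⟩
  filter_upwards [hF, hG] with z h1 h2
  rw [h1, h2, Pi.add_apply]
  ring

theorem const_mul {F : ℂ → ℂ} {p R : ℂ} (hF : HasAtMostSimplePole F p R) (c : ℂ) :
    HasAtMostSimplePole (fun z => c * F z) p (c * R) := by
  obtain ⟨f, hf, hF⟩ := hF
  refine ⟨fun z => c * f z, analyticAt_const.mul hf, ?_⟩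
  filter_upwards [hF] with z h1
  rw [h1]
  ring

theorem sum {ι : Type*} (s : Finset ι) {F : ι → ℂ → ℂ} {p : ℂ} {R : ι → ℂ}
    (h : ∀ i ∈ s, HasAtMostSimplePole (F i) p (R i)) :
    HasAtMostSimplePole (fun z => ∑ i ∈ s, F i z) p (∑ i ∈ s, R i) := by
  classical
  induction s using Finset.induction_on with
  | empty => simpa using of_analyticAt analyticAt_const
  | insert i s hi ih =>
    simp only [Finset.sum_insert hi]
    exact (h i (Finset.mem_insert_self i s)).add
      (ih fun j hj => h j (Finset.mem_insert_of_mem hj))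

theorem meromorphicAt {F : ℂ → ℂ} {p R : ℂ} (h : HasAtMostSimplePole F p R) :
    MeromorphicAt F p := by
  obtain ⟨g, hg, hF⟩ := h
  have h1 : MeromorphicAt (fun z => R / (z - p) + g z) p :=
    ((MeromorphicAt.const R p).div
      ((MeromorphicAt.id p).sub (MeromorphicAt.const p p))).add hg.meromorphicAt
  exact h1.congr (hF.mono fun z hz => hz.symm)

end HasAtMostSimplePole

theorem analyticAt_hurwitz_sub {a : ℝ} (ha : 0 < a) {c p : ℂ} (hp : p - c ≠ 1) :
    AnalyticAt ℂ (fun z => hurwitz (z - c) a) p := by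
  rw [Complex.analyticAt_iff_eventually_differentiableAt]
  have : ∀ᶠ z in 𝓝 p, z - c ≠ 1 :=
    ((continuous_id.sub continuous_const).continuousAt).eventually_ne hp
  filter_upwards [this] with z hz
  exact (differentiableAt_hurwitz ha hz).comp z (differentiableAt_id.sub_const c)

theorem hasAtMostSimplePole_hurwitz_sub {a : ℝ} (ha : 0 < a) (c p : ℂ) :
    HasAtMostSimplePole (fun z => hurwitz (z - c) a) p (if p - c = 1 then 1 else 0) := by
  obtain ⟨g, hg, h⟩ := exists_hurwitz_eq_add ha
  split_ifs with hp
  · refine ⟨fun z => g (z - c), (hg.comp (differentiable_id.sub_const c)).analyticAt p, ?_⟩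
    filter_upwards [self_mem_nhdsWithin] with z hz
    have hz1 : z - c ≠ 1 := fun h => hz (show z = p by linear_combination h - hp)
    rw [h _ hz1]
    congr 2
    linear_combination hp
  · exact .of_analyticAt (analyticAt_hurwitz_sub ha hp)

theorem meromorphic_of_onePoleSet {F : ℂ → ℂ} {N : ℕ}
    (h1 : ∀ z, z ∉ onePoleSet N → AnalyticAt ℂ F z)
    (h2 : ∀ k : ℕ, k < N → ∃ R, HasAtMostSimplePole F ((k : ℂ) + 1) R) : Meromorphic F := by
  intro z
  by_cases hz : z ∈ onePoleSet N
  · obtain ⟨k, hk1, hkN, rfl⟩ := hz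
    obtain ⟨j, rfl⟩ := Nat.exists_eq_add_of_le' hk1
    obtain ⟨R, hR⟩ := h2 j (by omega)
    simpa using hR.meromorphicAt
  · exact (h1 z hz).meromorphicAt

/-! ### Identification of meromorphic continuations -/

/-- The difference vanishes near a point of the common half-plane, so has infinite order there;
infinite order propagates over connected `ℂ`. Only punctured neighbourhoods are covered, since the
values of `F₀` at its poles are arbitrary. -/
theorem IsMeromorphicContinuation.eventuallyEq {f : ℕ → ℂ → ℂ} {F F₀ : ℂ → ℂ}
    (hF : IsMeromorphicContinuation f F) (hF₀ : Meromorphic F₀) {σ : ℝ}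
    (hsum : ∀ z : ℂ, σ < z.re → HasSum (fun n => f n z) (F₀ z)) (p : ℂ) :
    F =ᶠ[𝓝[≠] p] F₀ := by
  obtain ⟨hNF, τ, hτ⟩ := hF
  have hM : Meromorphic (F - F₀) := fun z =>
    (hNF (Set.mem_univ z)).meromorphicAt.sub (hF₀ z)
  obtain ⟨x, hx⟩ := exists_gt (max σ τ)
  have hev : ∀ᶠ z : ℂ in 𝓝 (x : ℂ), (F - F₀) z = 0 := by
    have : ∀ᶠ z : ℂ in 𝓝 (x : ℂ), max σ τ < z.re :=
      (isOpen_lt continuous_const Complex.continuous_re).mem_nhds (by simpa using hx)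
    filter_upwards [this] with z hz
    have h1 := hτ z ((le_max_right _ _).trans_lt hz)
    have h2 := hsum z ((le_max_left _ _).trans_lt hz)
    rw [Pi.sub_apply, h1.unique h2, sub_self]
  have htop : meromorphicOrderAt (F - F₀) (x : ℂ) = ⊤ :=
    meromorphicOrderAt_eq_top_iff.mpr (hev.filter_mono nhdsWithin_le_nhds)
  have htop' : meromorphicOrderAt (F - F₀) p = ⊤ := by
    by_contra hne
    exact (hM.meromorphicOn (s := Set.univ)).meromorphicOrderAt_ne_top_of_isPreconnected
      isPreconnected_univ (Set.mem_univ p) (Set.mem_univ (x : ℂ)) hne htop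
  filter_upwards [meromorphicOrderAt_eq_top_iff.mp htop'] with z hz
  exact sub_eq_zero.mp hz

/-- Passing to the normal form corrects the values of `F₀` at its poles and changes nothing on the
half-plane, where `F₀` is analytic. -/
theorem isMeromorphicContinuation_meromorphicContinuation {f : ℕ → ℂ → ℂ} {F₀ : ℂ → ℂ}
    (hF₀ : Meromorphic F₀) {σ : ℝ}
    (hsum : ∀ z : ℂ, σ < z.re → HasSum (fun n => f n z) (F₀ z))
    (han : ∀ z : ℂ, σ < z.re → AnalyticAt ℂ F₀ z) :
    IsMeromorphicContinuation f (meromorphicContinuation f) := by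
  have hex : ∃ F, IsMeromorphicContinuation f F := by
    have hM : MeromorphicOn F₀ Set.univ := hF₀.meromorphicOn
    refine ⟨toMeromorphicNFOn F₀ Set.univ, meromorphicNFOn_toMeromorphicNFOn F₀ Set.univ, σ, ?_⟩
    intro z hz
    rw [toMeromorphicNFOn_eq_toMeromorphicNFAt hM (Set.mem_univ z),
      toMeromorphicNFAt_eq_self.mpr (han z hz).meromorphicNFAt]
    exact hsum z hz
  rw [meromorphicContinuation, dif_pos hex]
  exact hex.choose_spec

theorem IsMeromorphicContinuation.eventuallyEq_nhds {f : ℕ → ℂ → ℂ} {F F₀ : ℂ → ℂ}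
    (hF : IsMeromorphicContinuation f F) (hF₀ : Meromorphic F₀) {σ : ℝ}
    (hsum : ∀ z : ℂ, σ < z.re → HasSum (fun n => f n z) (F₀ z)) {p : ℂ}
    (hp : AnalyticAt ℂ F₀ p) : F =ᶠ[𝓝 p] F₀ :=
  ((hF.1 (Set.mem_univ p)).eventuallyEq_nhdsNE_iff_eventuallyEq_nhds hp.meromorphicNFAt).mp
    (hF.eventuallyEq hF₀ hsum p)

/-! ### Zeta functions of eventually polynomial sequences -/

/-- The explicit form of the continuation of `∑ H n / (n + w) ^ z`, for a sequence `H` that agrees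
with `∑ k < N, d k * n ^ k` for `n ≥ A`. -/
def polyZetaBarnes (H d : ℕ → ℂ) (A N : ℕ) (w : ℝ) (z : ℂ) : ℂ :=
  ∑ n ∈ Finset.range A, H n / ((n : ℂ) + (w : ℂ)) ^ z +
    ∑ k ∈ Finset.range N, d k * ∑ l ∈ Finset.range (k + 1),
      (k.choose l : ℂ) * (-(w : ℂ)) ^ l * hurwitz (z - (k : ℂ) + (l : ℂ)) ((A : ℝ) + w)

/-- The explicit form of the continuation of `∑ H n / n ^ z`, where `n` runs over the positive
integers, for a sequence `H` that agrees with `∑ k < N, d k * n ^ k` for `n ≥ A`. -/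
def polyZeta (H d : ℕ → ℂ) (A N : ℕ) (z : ℂ) : ℂ :=
  ∑ n ∈ Finset.Ico 1 A, H n / (n : ℂ) ^ z +
    ∑ k ∈ Finset.range N, d k * hurwitz (z - (k : ℂ)) ((max A 1 : ℕ) : ℝ)

theorem sub_natCast_ne_one_of_notMem_onePoleSet {N : ℕ} {z : ℂ} (hz : z ∉ onePoleSet N)
    {j : ℕ} (hj : j < N) : z - (j : ℂ) ≠ 1 := fun h =>
  hz ⟨j + 1, by omega, by omega, by push_cast; linear_combination h⟩

theorem sub_add_natCast_ne_one_of_notMem_onePoleSet {N : ℕ} {z : ℂ} (hz : z ∉ onePoleSet N)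
    {k l : ℕ} (hk : k < N) (hl : l ≤ k) : z - ((k : ℂ) - (l : ℂ)) ≠ 1 := by
  rw [← Nat.cast_sub hl]
  exact sub_natCast_ne_one_of_notMem_onePoleSet hz (by omega)

theorem analyticAt_const_div_cpow (c : ℂ) {x : ℂ} (hx : x ≠ 0) (z : ℂ) :
    AnalyticAt ℂ (fun z => c / x ^ z) z := by
  refine Differentiable.analyticAt (fun z => ?_) z
  refine (differentiableAt_const c).div (differentiableAt_id.const_cpow (Or.inl hx)) ?_
  rw [Ne, Complex.cpow_eq_zero_iff]
  exact fun h => hx h.1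

theorem natCast_add_ofReal_ne_zero {w : ℝ} (hw : 0 < w) (n : ℕ) : (n : ℂ) + (w : ℂ) ≠ 0 := by
  have : 0 < (n : ℝ) + w := by positivity
  exact_mod_cast this.ne'

theorem analyticAt_polyZetaBarnes (H d : ℕ → ℂ) (A N : ℕ) {w : ℝ} (hw : 0 < w) {z : ℂ}
    (hz : z ∉ onePoleSet N) : AnalyticAt ℂ (polyZetaBarnes H d A N w) z := by
  refine AnalyticAt.add (Finset.analyticAt_fun_sum _ fun n _ => ?_)
    (Finset.analyticAt_fun_sum _ fun k hk => analyticAt_const.mul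
      (Finset.analyticAt_fun_sum _ fun l hl => analyticAt_const.mul ?_))
  · exact analyticAt_const_div_cpow _ (natCast_add_ofReal_ne_zero hw n) z
  · simp only [sub_add]
    refine analyticAt_hurwitz_sub (by positivity) ?_
    exact sub_add_natCast_ne_one_of_notMem_onePoleSet hz (Finset.mem_range.mp hk)
      (Finset.mem_range_succ_iff.mp hl)

theorem analyticAt_polyZeta (H d : ℕ → ℂ) (A N : ℕ) {z : ℂ}
    (hz : z ∉ onePoleSet N) : AnalyticAt ℂ (polyZeta H d A N) z := by
  refine AnalyticAt.add (Finset.analyticAt_fun_sum _ fun n hn => ?_)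
    (Finset.analyticAt_fun_sum _ fun k hk => analyticAt_const.mul ?_)
  · refine analyticAt_const_div_cpow _ (Nat.cast_ne_zero.mpr ?_) z
    have := (Finset.mem_Ico.mp hn).1
    omega
  · refine analyticAt_hurwitz_sub (by positivity) ?_
    exact sub_natCast_ne_one_of_notMem_onePoleSet hz (Finset.mem_range.mp hk)

theorem hasAtMostSimplePole_polyZetaBarnes (H d : ℕ → ℂ) (A N : ℕ) {w : ℝ} (hw : 0 < w) (k : ℕ) :
    HasAtMostSimplePole (polyZetaBarnes H d A N w) ((k : ℂ) + 1)
      (∑ l ∈ Finset.Ico k N, (l.choose k : ℂ) * (-(w : ℂ)) ^ (l - k) * d l) := by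
  have h1 : HasAtMostSimplePole (fun z => ∑ n ∈ Finset.range A, H n / ((n : ℂ) + (w : ℂ)) ^ z)
      ((k : ℂ) + 1) 0 := .of_analyticAt <| Finset.analyticAt_fun_sum _ fun n _ =>
        analyticAt_const_div_cpow _ (natCast_add_ofReal_ne_zero hw n) _
  have h2 := HasAtMostSimplePole.sum (p := (k : ℂ) + 1) (Finset.range N) fun j _ =>
    (HasAtMostSimplePole.sum (Finset.range (j + 1)) fun l _ =>
      (hasAtMostSimplePole_hurwitz_sub (a := (A : ℝ) + w) (by positivity) ((j : ℂ) - (l : ℂ))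
        ((k : ℂ) + 1)).const_mul ((j.choose l : ℂ) * (-(w : ℂ)) ^ l)).const_mul (d j)
  simp only [← sub_add] at h2
  have h3 := h1.add h2
  rw [zero_add] at h3
  convert! h3 using 1
  -- The summand `(j, l)` has a pole at `k + 1` exactly when `l = j - k`: none for `j < k`, one for
  -- `j ≥ k`.
  rw [Finset.range_eq_Ico, ← Finset.sum_subset (Finset.Ico_subset_Ico_left (Nat.zero_le k))]
  · refine Finset.sum_congr rfl fun j hj => ?_
    have hkj := (Finset.mem_Ico.mp hj).1
    rw [Finset.sum_eq_single (j - k)]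
    · rw [if_pos (by rw [Nat.cast_sub hkj]; ring), Nat.choose_symm hkj]
      ring
    · intro l _ hl
      rw [if_neg, mul_zero]
      intro h
      apply hl
      have : (k + l : ℂ) = j := by linear_combination h
      have : k + l = j := by exact_mod_cast this
      omega
    · intro h
      exact absurd (Finset.mem_range.mpr (by omega)) h
  · intro j hj hjk
    rw [Finset.sum_eq_zero, mul_zero]
    intro l hl
    rw [if_neg, mul_zero]
    intro h
    apply hjk
    have : (k + l : ℂ) = j := by linear_combination h
    have : k + l = j := by exact_mod_cast this
    have := Finset.mem_Ico.mp hj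
    exact Finset.mem_Ico.mpr ⟨by omega, by omega⟩

theorem hasAtMostSimplePole_polyZeta (H d : ℕ → ℂ) (A N : ℕ) {k : ℕ} (hk : k < N) :
    HasAtMostSimplePole (polyZeta H d A N) ((k : ℂ) + 1) (d k) := by
  have h1 : HasAtMostSimplePole (fun z => ∑ n ∈ Finset.Ico 1 A, H n / (n : ℂ) ^ z)
      ((k : ℂ) + 1) 0 := .of_analyticAt <| Finset.analyticAt_fun_sum _ fun n hn => by
        refine analyticAt_const_div_cpow _ (Nat.cast_ne_zero.mpr ?_) _
        have := (Finset.mem_Ico.mp hn).1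
        omega
  have h2 := HasAtMostSimplePole.sum (p := (k : ℂ) + 1) (Finset.range N) fun j _ =>
    (hasAtMostSimplePole_hurwitz_sub (a := ((max A 1 : ℕ) : ℝ)) (by positivity) (j : ℂ)
        ((k : ℂ) + 1)).const_mul (d j)
  have h3 := h1.add h2
  rw [zero_add] at h3
  convert! h3 using 1
  rw [Finset.sum_eq_single k]
  · rw [if_pos (by ring), mul_one]
  · intro j _ hj
    rw [if_neg, mul_zero]
    intro h
    have : (k : ℂ) = j := by linear_combination h
    exact hj (by exact_mod_cast this.symm)
  · intro h
    exact absurd (Finset.mem_range.mpr hk) h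

theorem meromorphic_polyZetaBarnes (H d : ℕ → ℂ) (A N : ℕ) {w : ℝ} (hw : 0 < w) :
    Meromorphic (polyZetaBarnes H d A N w) :=
  meromorphic_of_onePoleSet (fun _ hz => analyticAt_polyZetaBarnes H d A N hw hz)
    fun k _ => ⟨_, hasAtMostSimplePole_polyZetaBarnes H d A N hw k⟩

theorem notMem_onePoleSet_of_lt_re {N : ℕ} {z : ℂ} (hz : (N : ℝ) < z.re) : z ∉ onePoleSet N := by
  rintro ⟨k, -, hk, rfl⟩
  rw [Complex.natCast_re, Nat.cast_lt] at hz
  omega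

theorem hasSum_polyZetaBarnes {H d : ℕ → ℂ} {A N : ℕ}
    (hH : ∀ n, A ≤ n → H n = ∑ k ∈ Finset.range N, d k * (n : ℂ) ^ k) {w : ℝ} (hw : 0 < w) {z : ℂ}
    (hz : (N : ℝ) < z.re) :
    HasSum (fun n : ℕ => H n / ((n : ℂ) + (w : ℂ)) ^ z) (polyZetaBarnes H d A N w z) := by
  have hAw : 0 < (A : ℝ) + w := by positivity
  have h1 := hasSum_sum (s := Finset.range N) fun k hk =>
    (hasSum_sum (s := Finset.range (k + 1)) fun l hl =>
      (hasSum_hurwitz hAw (s := z - (k : ℂ) + (l : ℂ)) (by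
        have : (k : ℝ) + 1 ≤ N := by exact_mod_cast Finset.mem_range.mp hk
        have := Nat.cast_nonneg (α := ℝ) l
        simp
        linarith)).mul_left ((k.choose l : ℂ) * (-(w : ℂ)) ^ l)).mul_left (d k)
  rw [polyZetaBarnes, add_comm]
  refine (hasSum_nat_add_iff A).mp (h1.congr_fun fun n => ?_)
  rw [hH (n + A) (by omega), Finset.sum_div]
  refine Finset.sum_congr rfl fun k _ => ?_
  rw [mul_div_assoc]
  congr 1
  have hx0 : ((n + A : ℕ) : ℂ) + (w : ℂ) ≠ 0 := natCast_add_ofReal_ne_zero hw _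
  have hx : (n : ℂ) + (((A : ℝ) + w : ℝ) : ℂ) = ((n + A : ℕ) : ℂ) + (w : ℂ) := by
    push_cast; ring
  rw [hx]
  set x : ℂ := ((n + A : ℕ) : ℂ) + (w : ℂ) with hxdef
  -- Expanding the power of `n + A = -w + x` binomially turns it into powers of `x`, which merge
  -- with `x ^ (-z)`.
  have hxw : ((n + A : ℕ) : ℂ) = -(w : ℂ) + x := by rw [hxdef]; ring
  rw [hxw, add_pow, Finset.sum_div]
  refine Finset.sum_congr rfl fun l hl => ?_
  have hlk : l ≤ k := Finset.mem_range_succ_iff.mp hl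
  have hsplit : x ^ (z - (k : ℂ) + (l : ℂ)) = x ^ z / x ^ (k - l) := by
    rw [sub_add, ← Nat.cast_sub hlk, Complex.cpow_sub _ _ hx0, Complex.cpow_natCast]
  rw [hsplit]
  field_simp

/-- Both sides continue the same series. Raising the cutoff keeps the Hurwitz parameter `A + w` away
from `0` as `w ↘ 0` when `A = 0`. -/
theorem polyZetaBarnes_eq_of_le {H d : ℕ → ℂ} {A B N : ℕ} (hAB : A ≤ B)
    (hH : ∀ n, A ≤ n → H n = ∑ k ∈ Finset.range N, d k * (n : ℂ) ^ k) {w : ℝ} (hw : 0 < w) {z : ℂ}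
    (hz : z ∉ onePoleSet N) : polyZetaBarnes H d A N w z = polyZetaBarnes H d B N w z := by
  have hA := meromorphic_polyZetaBarnes H d A N hw
  have hB := meromorphic_polyZetaBarnes H d B N hw
  have sA := fun z => hasSum_polyZetaBarnes hH hw (z := z)
  have sB := fun z => hasSum_polyZetaBarnes (A := B) (fun n hn => hH n (hAB.trans hn)) hw (z := z)
  have hF := isMeromorphicContinuation_meromorphicContinuation hA sA fun z hz =>
    analyticAt_polyZetaBarnes H d A N hw (notMem_onePoleSet_of_lt_re hz)
  exact (hF.eventuallyEq_nhds hA sA (analyticAt_polyZetaBarnes H d A N hw hz)).self_of_nhds.symm.trans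
    (hF.eventuallyEq_nhds hB sB (analyticAt_polyZetaBarnes H d B N hw hz)).self_of_nhds

/-- For `A ≥ 1` the term `n = 0` cancels exactly against the subtracted one. Everything else is
continuous at `w = 0`, where only `l = 0` survives. -/
theorem tendsto_polyZetaBarnes_sub_of_pos (H d : ℕ → ℂ) {A N : ℕ} (hA : 1 ≤ A) {z : ℂ}
    (hz : z ∉ onePoleSet N) :
    Tendsto (fun w : ℝ => polyZetaBarnes H d A N w z - H 0 * (w : ℂ) ^ (-z)) (𝓝[>] (0 : ℝ))
      (𝓝 (polyZeta H d A N z)) := by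
  have hA0 : (0 : ℝ) < A := by exact_mod_cast hA
  have key : ContinuousAt (fun w : ℝ => ∑ n ∈ Finset.Ico 1 A, H n / ((n : ℂ) + (w : ℂ)) ^ z +
      ∑ k ∈ Finset.range N, d k * ∑ l ∈ Finset.range (k + 1),
        (k.choose l : ℂ) * (-(w : ℂ)) ^ l * hurwitz (z - (k : ℂ) + (l : ℂ)) ((A : ℝ) + w)) 0 := by
    refine ContinuousAt.add (tendsto_finsetSum _ fun n hn => ?_)
      (tendsto_finsetSum _ fun k hk => Tendsto.const_mul _
        (tendsto_finsetSum _ fun l hl => ?_))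
    · have hn1 := (Finset.mem_Ico.mp hn).1
      have hn0 : (n : ℂ) ≠ 0 := Nat.cast_ne_zero.mpr (by omega)
      have hc : ContinuousAt (fun w : ℝ => ((n : ℂ) + (w : ℂ)) ^ z) 0 := by
        refine ContinuousAt.cpow (by fun_prop) continuousAt_const (Or.inl ?_)
        simp
        omega
      refine Tendsto.div tendsto_const_nhds hc.tendsto ?_
      rw [Ne, Complex.cpow_eq_zero_iff]
      exact fun h => hn0 (by simpa using h.1)
    · have hne : z - (k : ℂ) + (l : ℂ) ≠ 1 := by
        rw [sub_add]
        exact sub_add_natCast_ne_one_of_notMem_onePoleSet hz (Finset.mem_range.mp hk)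
          (Finset.mem_range_succ_iff.mp hl)
      have h1 : ContinuousAt (fun a : ℝ => hurwitz (z - (k : ℂ) + (l : ℂ)) a) ((A : ℝ) + 0) := by
        rw [add_zero]
        exact continuousAt_hurwitz_param hA0 hne
      have h2 : ContinuousAt (fun w : ℝ => hurwitz (z - (k : ℂ) + (l : ℂ)) ((A : ℝ) + w)) 0 :=
        ContinuousAt.comp (f := fun w : ℝ => (A : ℝ) + w) h1 (by fun_prop)
      exact (ContinuousAt.mul (by fun_prop) h2).tendsto
  have hlim := key.tendsto.mono_left (nhdsWithin_le_nhds (s := Set.Ioi 0))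
  have hval : (∑ n ∈ Finset.Ico 1 A, H n / ((n : ℂ) + ((0 : ℝ) : ℂ)) ^ z +
      ∑ k ∈ Finset.range N, d k * ∑ l ∈ Finset.range (k + 1), (k.choose l : ℂ) *
        (-((0 : ℝ) : ℂ)) ^ l * hurwitz (z - (k : ℂ) + (l : ℂ)) ((A : ℝ) + 0))
      = polyZeta H d A N z := by
    rw [polyZeta, max_eq_left hA]
    congr 1
    · simp
    · refine Finset.sum_congr rfl fun k _ => ?_
      rw [Finset.sum_eq_single 0]
      · simp
      · intro l _ hl
        simp [hl]
      · simp
  rw [hval] at hlim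
  refine hlim.congr' (Eventually.of_forall fun w => ?_)
  simp only [polyZetaBarnes]
  have hrange : Finset.range A = Finset.Ico 0 A := Finset.range_eq_Ico ..
  rw [hrange, Finset.sum_eq_sum_Ico_succ_bot (show 0 < A from hA), Complex.cpow_neg]
  simp only [Nat.cast_zero, zero_add, div_eq_mul_inv]
  ring

theorem tendsto_polyZetaBarnes_sub {H d : ℕ → ℂ} {A N : ℕ}
    (hH : ∀ n, A ≤ n → H n = ∑ k ∈ Finset.range N, d k * (n : ℂ) ^ k) {z : ℂ}
    (hz : z ∉ onePoleSet N) :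
    Tendsto (fun w : ℝ => polyZetaBarnes H d A N w z - H 0 * (w : ℂ) ^ (-z)) (𝓝[>] (0 : ℝ))
      (𝓝 (polyZeta H d A N z)) := by
  have h1 : polyZeta H d A N z = polyZeta H d (max A 1) N z := by
    rcases Nat.eq_zero_or_pos A with rfl | hA
    · simp [polyZeta]
    · rw [max_eq_left hA]
  rw [h1]
  refine (tendsto_polyZetaBarnes_sub_of_pos H d (le_max_right A 1) hz).congr' ?_
  filter_upwards [self_mem_nhdsWithin] with w hw
  rw [polyZetaBarnes_eq_of_le (le_max_left A 1) hH hw hz]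

/-! ### Application to iterated Hilbert functions -/

section Zeta

variable {K M : Type*} [Field K] [AddCommGroup M] [Module K M] (ℳ : ℕ → Submodule K M)

/-- This is why the subtracted term has coefficient `H(M, 0)` for every `i`. -/
theorem iteratedHilbert_apply_zero (i : ℕ) : iteratedHilbert ℳ i 0 = hilbertFunction ℳ 0 := by
  induction i with
  | zero => rfl
  | succ i ih => simp [iteratedHilbert, ih]

variable {ℳ} {i N : ℕ} {P : Polynomial ℚ}

theorem hilbertPolynomial_eq_of_eventually
    (hP : ∀ᶠ n : ℕ in atTop, (iteratedHilbert ℳ i n : ℚ) = P.eval (n : ℚ)) :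
    hilbertPolynomial ℳ i = P := by
  have hex : ∃ P : Polynomial ℚ, ∀ᶠ n : ℕ in atTop,
    (iteratedHilbert ℳ i n : ℚ) = P.eval (n : ℚ) := ⟨P, hP⟩
  rw [hilbertPolynomial, dif_pos hex]
  obtain ⟨n₀, h₀⟩ := eventually_atTop.mp (hex.choose_spec.and hP)
  refine Polynomial.eq_of_infinite_eval_eq _ _
    (Set.infinite_of_injective_forall_mem (f := fun n : ℕ => ((n + n₀ : ℕ) : ℚ)) ?_ ?_)
  · intro a b h
    exact Nat.add_right_cancel (Nat.cast_injective (R := ℚ) h)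
  · intro n
    obtain ⟨h1, h2⟩ := h₀ (n + n₀) (by omega)
    exact h1.symm.trans h2

theorem iteratedHilbert_eq_eval_of_hilbertAlpha_le
    (hP : ∀ᶠ n : ℕ in atTop, (iteratedHilbert ℳ i n : ℚ) = P.eval (n : ℚ)) {n : ℕ}
    (hn : hilbertAlpha ℳ i ≤ n) :
    (iteratedHilbert ℳ i n : ℚ) = (hilbertPolynomial ℳ i).eval (n : ℚ) := by
  have hne : {n₀ : ℕ | ∀ n : ℕ, n₀ ≤ n →
      (iteratedHilbert ℳ i n : ℚ) = (hilbertPolynomial ℳ i).eval (n : ℚ)}.Nonempty := by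
    rw [hilbertPolynomial_eq_of_eventually hP]
    exact eventually_atTop.mp hP
  exact Nat.sInf_mem hne n hn

theorem iteratedHilbert_eq_sum_of_hilbertAlpha_le
    (hP : ∀ᶠ n : ℕ in atTop, (iteratedHilbert ℳ i n : ℚ) = P.eval (n : ℚ))
    (hdeg : P.degree < (N : WithBot ℕ)) {n : ℕ} (hn : hilbertAlpha ℳ i ≤ n) :
    (iteratedHilbert ℳ i n : ℂ) = ∑ k ∈ Finset.range N, hilbertCoeff ℳ i k * (n : ℂ) ^ k := by
  have h1 := iteratedHilbert_eq_eval_of_hilbertAlpha_le hP hn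
  rw [hilbertPolynomial_eq_of_eventually hP] at h1
  have h2 : P.eval (n : ℚ) = ∑ k ∈ Finset.range N, P.coeff k * (n : ℚ) ^ k := by
    rcases eq_or_ne P 0 with rfl | h0
    · simp
    · exact Polynomial.eval_eq_sum_range' ((Polynomial.natDegree_lt_iff_degree_lt h0).mpr hdeg) _
  rw [h2] at h1
  simp only [hilbertCoeff, hilbertPolynomial_eq_of_eventually hP]
  exact_mod_cast congrArg (fun q : ℚ => (q : ℂ)) h1

theorem higherZeta_of_eventually_eq_eval
    (hP : ∀ᶠ n : ℕ in atTop, (iteratedHilbert ℳ i n : ℚ) = P.eval (n : ℚ))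
    (hdeg : P.degree < (N : WithBot ℕ)) :
    ((hilbertPolynomial ℳ i).degree < (N : WithBot ℕ) ∧
      ∀ n : ℕ, hilbertAlpha ℳ i ≤ n →
        (iteratedHilbert ℳ i n : ℚ) = (hilbertPolynomial ℳ i).eval (n : ℚ)) ∧
    (∀ w : ℝ, 0 < w →
      (∀ z : ℂ, (N : ℝ) < z.re →
        HasSum (fun n : ℕ => (iteratedHilbert ℳ i n : ℂ) / ((n : ℂ) + (w : ℂ)) ^ z)
          (higherZetaBarnes ℳ i w z)) ∧
      (∀ z : ℂ, z ∉ onePoleSet N →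
        higherZetaBarnes ℳ i w z = higherThetaBarnes ℳ i w z +
          ∑ k ∈ Finset.range N, hilbertCoeff ℳ i k *
            ∑ l ∈ Finset.range (k + 1), (k.choose l : ℂ) * (-(w : ℂ)) ^ l *
              hurwitz (z - (k : ℂ) + (l : ℂ)) ((hilbertAlpha ℳ i : ℝ) + w)) ∧
      Meromorphic (higherZetaBarnes ℳ i w) ∧
      (∀ z : ℂ, z ∉ onePoleSet N → AnalyticAt ℂ (higherZetaBarnes ℳ i w) z) ∧
      ∀ k : ℕ, k < N →
        HasAtMostSimplePole (higherZetaBarnes ℳ i w) ((k : ℂ) + 1)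
          (∑ l ∈ Finset.Ico k N,
            (l.choose k : ℂ) * (-(w : ℂ)) ^ (l - k) * hilbertCoeff ℳ i l)) ∧
    ((∀ z : ℂ, z ∉ onePoleSet N →
        Tendsto (fun w : ℝ =>
            higherZetaBarnes ℳ i w z - (hilbertFunction ℳ 0 : ℂ) * (w : ℂ) ^ (-z))
          (𝓝[>] (0 : ℝ)) (𝓝 (higherZeta ℳ i z))) ∧
      (∀ z : ℂ, z ∉ onePoleSet N →
        higherZeta ℳ i z = higherTheta ℳ i z +
          ∑ k ∈ Finset.range N, hilbertCoeff ℳ i k *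
            hurwitz (z - (k : ℂ)) ((max (hilbertAlpha ℳ i) 1 : ℕ) : ℝ)) ∧
      Meromorphic (higherZeta ℳ i) ∧
      (∀ z : ℂ, z ∉ onePoleSet N → AnalyticAt ℂ (higherZeta ℳ i) z) ∧
      ∀ k : ℕ, k < N →
        HasAtMostSimplePole (higherZeta ℳ i) ((k : ℂ) + 1) (hilbertCoeff ℳ i k)) := by
  set H : ℕ → ℂ := fun n => (iteratedHilbert ℳ i n : ℂ) with hHdef
  set d : ℕ → ℂ := hilbertCoeff ℳ i with hd
  set A : ℕ := hilbertAlpha ℳ i with hA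
  have hH : ∀ n, A ≤ n → H n = ∑ k ∈ Finset.range N, d k * (n : ℂ) ^ k := fun n hn =>
    iteratedHilbert_eq_sum_of_hilbertAlpha_le hP hdeg hn
  have hcont : ∀ w : ℝ, 0 < w → IsMeromorphicContinuation
      (fun (n : ℕ) (z : ℂ) => H n / ((n : ℂ) + (w : ℂ)) ^ z) (higherZetaBarnes ℳ i w) :=
    fun w hw => isMeromorphicContinuation_meromorphicContinuation
      (meromorphic_polyZetaBarnes H d A N hw) (fun z => hasSum_polyZetaBarnes hH hw)
      fun z hz => analyticAt_polyZetaBarnes H d A N hw (notMem_onePoleSet_of_lt_re hz)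
  have hnhds : ∀ w : ℝ, 0 < w → ∀ z, z ∉ onePoleSet N →
      higherZetaBarnes ℳ i w =ᶠ[𝓝 z] polyZetaBarnes H d A N w := fun w hw z hz =>
    (hcont w hw).eventuallyEq_nhds (meromorphic_polyZetaBarnes H d A N hw)
      (fun z => hasSum_polyZetaBarnes hH hw) (analyticAt_polyZetaBarnes H d A N hw hz)
  have heq : ∀ w : ℝ, 0 < w → ∀ z, z ∉ onePoleSet N →
      higherZetaBarnes ℳ i w z = polyZetaBarnes H d A N w z := fun w hw z hz =>
    (hnhds w hw z hz).self_of_nhds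
  have hlim : ∀ z : ℂ, z ∉ onePoleSet N → Tendsto (fun w : ℝ =>
      higherZetaBarnes ℳ i w z - (hilbertFunction ℳ 0 : ℂ) * (w : ℂ) ^ (-z))
      (𝓝[>] (0 : ℝ)) (𝓝 (polyZeta H d A N z)) := fun z hz => by
    refine (tendsto_polyZetaBarnes_sub hH hz).congr' ?_
    filter_upwards [self_mem_nhdsWithin] with w hw
    rw [heq w hw z hz]
    simp only [hHdef, iteratedHilbert_apply_zero]
  have hzeta : ∀ z : ℂ, z ∉ onePoleSet N → higherZeta ℳ i z = polyZeta H d A N z :=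
    fun z hz => (hlim z hz).limUnder_eq
  have hfin : (onePoleSet N).Finite := by
    refine ((Set.finite_Iic N).image (fun k : ℕ => (k : ℂ))).subset ?_
    rintro _ ⟨k, -, hk, rfl⟩
    exact ⟨k, hk, rfl⟩
  have hzeta_nhds : ∀ z, z ∉ onePoleSet N → higherZeta ℳ i =ᶠ[𝓝 z] polyZeta H d A N := fun z hz => by
    filter_upwards [hfin.isClosed.isOpen_compl.mem_nhds hz] with y hy using hzeta y hy
  -- At a pole `higherZeta` is a `limUnder` with no controlled value; as the pole set is finite, a
  -- punctured neighbourhood avoids it.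
  have hzeta_ne : ∀ z, higherZeta ℳ i =ᶠ[𝓝[≠] z] polyZeta H d A N := fun z => by
    have h1 : (onePoleSet N \ {z})ᶜ ∈ 𝓝 z :=
      (hfin.subset Set.sdiff_subset).isClosed.isOpen_compl.mem_nhds fun h => h.2 rfl
    filter_upwards [mem_nhdsWithin_of_mem_nhds h1, self_mem_nhdsWithin] with y hy hyz
    exact hzeta y fun h => hy ⟨h, hyz⟩
  have hzeta_an : ∀ z, z ∉ onePoleSet N → AnalyticAt ℂ (higherZeta ℳ i) z := fun z hz =>
    (analyticAt_polyZeta H d A N hz).congr (hzeta_nhds z hz).symm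
  have hzeta_pole : ∀ k : ℕ, k < N → HasAtMostSimplePole (higherZeta ℳ i) ((k : ℂ) + 1) (d k) :=
    fun k hk => (hasAtMostSimplePole_polyZeta H d A N hk).congr (hzeta_ne _)
  refine ⟨⟨by rwa [hilbertPolynomial_eq_of_eventually hP],
    fun n hn => iteratedHilbert_eq_eval_of_hilbertAlpha_le hP hn⟩, fun w hw => ⟨fun z hz => ?_,
      heq w hw, fun z => ((hcont w hw).1 (Set.mem_univ z)).meromorphicAt, fun z hz => ?_,
      fun k _ => ?_⟩, fun z hz => ?_, hzeta, ?_, hzeta_an, hzeta_pole⟩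
  · rw [heq w hw z (notMem_onePoleSet_of_lt_re hz)]
    exact hasSum_polyZetaBarnes hH hw hz
  · exact (analyticAt_polyZetaBarnes H d A N hw hz).congr (hnhds w hw z hz).symm
  · exact (hasAtMostSimplePole_polyZetaBarnes H d A N hw k).congr
      ((hcont w hw).eventuallyEq (meromorphic_polyZetaBarnes H d A N hw)
        (fun z => hasSum_polyZetaBarnes hH hw) _)
  · rw [hzeta z hz]
    exact hlim z hz
  · exact meromorphic_of_onePoleSet hzeta_an fun k hk => ⟨_, hzeta_pole k hk⟩

end Zeta

/-! ### Eventually polynomial sequences -/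

/-- The `d`-th difference of `f` vanishes eventually; that is, `f` agrees eventually with a
polynomial of degree less than `d`. -/
def EventuallyPolyLT (d : ℕ) (f : ℕ → ℚ) : Prop :=
  ∀ᶠ n in atTop, (fwdDiff 1)^[d] f n = 0

namespace EventuallyPolyLT

theorem add {d : ℕ} {f g : ℕ → ℚ} (hf : EventuallyPolyLT d f) (hg : EventuallyPolyLT d g) :
    EventuallyPolyLT d (f + g) := by
  filter_upwards [hf, hg] with n h1 h2
  rw [fwdDiff_iter_add, Pi.add_apply, h1, h2, add_zero]

theorem comp_add_iff {d : ℕ} {f : ℕ → ℚ} (a : ℕ) :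
    EventuallyPolyLT d (fun n => f (n + a)) ↔ EventuallyPolyLT d f := by
  simp only [EventuallyPolyLT, fwdDiff_iter_comp_add]
  conv_rhs => rw [← Filter.map_add_atTop_eq_nat a, Filter.eventually_map]

theorem succ {d : ℕ} {f : ℕ → ℚ} (h : EventuallyPolyLT d fun n => f (n + 1) - f n) :
    EventuallyPolyLT (d + 1) f := h

theorem congr {d : ℕ} {f g : ℕ → ℚ} (hf : EventuallyPolyLT d f) (hfg : ∀ᶠ n in atTop, g n = f n) :
    EventuallyPolyLT d g := by
  obtain ⟨a, ha⟩ := eventually_atTop.mp hfg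
  rw [← comp_add_iff a] at hf ⊢
  have : (fun n => g (n + a)) = fun n => f (n + a) := funext fun n => ha _ (by omega)
  rwa [this]

theorem zero (d : ℕ) : EventuallyPolyLT d fun _ => 0 := by
  induction d with
  | zero => exact Eventually.of_forall fun _ => rfl
  | succ d ih => exact succ (by simpa using ih)

/-- Newton's forward difference formula based at `a`, beyond which all differences of order at least
`d` vanish; `descPochhammer` over `k!` is the binomial coefficient `(n - a choose k)` as a
polynomial in `n`. -/
theorem exists_polynomial {d : ℕ} {f : ℕ → ℚ} (hf : EventuallyPolyLT d f) :
    ∃ P : Polynomial ℚ, P.degree < (d : WithBot ℕ) ∧ ∀ᶠ n : ℕ in atTop, f n = P.eval (n : ℚ) := by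
  obtain ⟨a, ha⟩ := eventually_atTop.mp hf
  have hvan : ∀ k, d ≤ k → ∀ y, a ≤ y → (fwdDiff 1)^[k] f y = 0 := by
    intro k hk
    induction k, hk using Nat.le_induction with
    | base => exact ha
    | succ k _ ih =>
      intro y hy
      rw [Function.iterate_succ_apply', fwdDiff, ih y hy, ih (y + 1) (by omega), sub_zero]
  have hQdeg : ∀ k < d, (Polynomial.C ((fwdDiff 1)^[k] f a / (k.factorial : ℚ)) *
      (descPochhammer ℚ k).comp (Polynomial.X - Polynomial.C (a : ℚ))).degree
      < (d : WithBot ℕ) := by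
    intro k hk
    refine lt_of_le_of_lt ?_ (WithBot.coe_lt_coe.mpr hk)
    refine (Polynomial.degree_le_natDegree).trans (WithBot.coe_le_coe.mpr ?_)
    refine (Polynomial.natDegree_C_mul_le _ _).trans ?_
    refine Polynomial.natDegree_comp_le.trans ?_
    rw [Polynomial.natDegree_X_sub_C, mul_one, descPochhammer_natDegree]
  refine ⟨∑ k ∈ Finset.range d, Polynomial.C ((fwdDiff 1)^[k] f a / (k.factorial : ℚ)) *
      (descPochhammer ℚ k).comp (Polynomial.X - Polynomial.C (a : ℚ)), ?_, ?_⟩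
  · exact Polynomial.mem_degreeLT.mp (Submodule.sum_mem _ fun k hk =>
      Polynomial.mem_degreeLT.mpr (hQdeg k (Finset.mem_range.mp hk)))
  · filter_upwards [eventually_ge_atTop (a + d)] with n hn
    obtain ⟨m, rfl⟩ := Nat.exists_eq_add_of_le (show a ≤ n by omega)
    have hN := shift_eq_sum_fwdDiff_iter 1 f m a
    rw [nsmul_one, Nat.cast_id] at hN
    rw [hN, Polynomial.eval_finsetSum, ← Finset.sum_subset (s₁ := Finset.range d)]
    · refine Finset.sum_congr rfl fun k _ => ?_
      rw [Polynomial.eval_mul, Polynomial.eval_C, Polynomial.eval_comp, Polynomial.eval_sub,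
        Polynomial.eval_X, Polynomial.eval_C, Nat.cast_add, add_sub_cancel_left,
        descPochhammer_eval_eq_descFactorial, Nat.descFactorial_eq_factorial_mul_choose,
        nsmul_eq_mul, Nat.cast_mul]
      field_simp
    · intro k hk
      simp only [Finset.mem_range] at hk ⊢
      omega
    · intro k _ hk
      rw [hvan k (by simpa using hk) a le_rfl, smul_zero]

end EventuallyPolyLT

/-! ### Homogeneous submodules -/

section Graded

variable {K S M : Type*} [Field K] [CommRing S] [Algebra K S]
  [AddCommGroup M] [Module S M] [Module K M]
  (ℳ : ℕ → Submodule K M)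

theorem smul_mem_add (𝒮 : ℕ → Submodule K S) [SetLike.GradedSMul 𝒮 ℳ] {a i : ℕ} {s : S} {x : M} (hs : s ∈ 𝒮 i) (hx : x ∈ ℳ a) :
    s • x ∈ ℳ (i + a) := SetLike.GradedSMul.smul_mem hs hx

theorem smul_eq_sum_decompose (𝒮 : ℕ → Submodule K S) [GradedAlgebra 𝒮]
    [∀ i (y : 𝒮 i), Decidable (y ≠ 0)] (s : S) (x : M) :
    s • x = ∑ i ∈ (DirectSum.decompose 𝒮 s).support, (DirectSum.decompose 𝒮 s i : S) • x := by
  rw [← Finset.sum_smul, DirectSum.sum_support_decompose]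

variable [DirectSum.Decomposition ℳ]

theorem decompose_smul_add (𝒮 : ℕ → Submodule K S) [GradedAlgebra 𝒮]
    [SetLike.GradedSMul 𝒮 ℳ] {a : ℕ} {x : M} (hx : x ∈ ℳ a) (s : S) (i : ℕ) :
    (DirectSum.decompose ℳ (s • x) (i + a) : M) = (DirectSum.decompose 𝒮 s i : S) • x := by
  classical
  rw [smul_eq_sum_decompose 𝒮, DirectSum.decompose_sum, DFinsupp.finsetSum_apply,
    AddSubmonoidClass.coe_finsetSum, Finset.sum_eq_single i]
  · exact DirectSum.decompose_of_mem_same ℳ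
      (smul_mem_add ℳ 𝒮 (DirectSum.decompose 𝒮 s i).2 hx)
  · intro j _ hj
    exact DirectSum.decompose_of_mem_ne ℳ
      (smul_mem_add ℳ 𝒮 (DirectSum.decompose 𝒮 s j).2 hx) (by omega)
  · intro hi
    rw [DFinsupp.notMem_support_iff.mp hi, ZeroMemClass.coe_zero, zero_smul,
      DirectSum.decompose_zero]
    rfl

theorem decompose_smul_of_lt (𝒮 : ℕ → Submodule K S) [GradedAlgebra 𝒮]
    [SetLike.GradedSMul 𝒮 ℳ] {a n : ℕ} {x : M} (hx : x ∈ ℳ a) (s : S) (hn : n < a) :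
    (DirectSum.decompose ℳ (s • x) n : M) = 0 := by
  classical
  rw [smul_eq_sum_decompose 𝒮, DirectSum.decompose_sum, DFinsupp.finsetSum_apply,
    AddSubmonoidClass.coe_finsetSum, Finset.sum_eq_zero]
  intro j _
  exact DirectSum.decompose_of_mem_ne ℳ
    (smul_mem_add ℳ 𝒮 (DirectSum.decompose 𝒮 s j).2 hx) (by omega)

variable {ℳ}

theorem exists_of_mem_sup_span {N : Submodule S M} (hN : N.IsHomogeneous ℳ) {n : ℕ} {x y : M}
    (hy : y ∈ N ⊔ Submodule.span S {x}) :
    ∃ s : S, (DirectSum.decompose ℳ y n : M) - (DirectSum.decompose ℳ (s • x) n : M) ∈ N := by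
  obtain ⟨u, hu, v, hv, rfl⟩ := Submodule.mem_sup.mp hy
  obtain ⟨s, rfl⟩ := Submodule.mem_span_singleton.mp hv
  refine ⟨s, ?_⟩
  rw [DirectSum.decompose_add, DFinsupp.add_apply, Submodule.coe_add, add_sub_cancel_right]
  exact hN n hu

theorem isHomogeneous_sup_span (𝒮 : ℕ → Submodule K S) [GradedAlgebra 𝒮]
    [SetLike.GradedSMul 𝒮 ℳ] {N : Submodule S M} (hN : N.IsHomogeneous ℳ) {a : ℕ} {x : M}
    (hx : x ∈ ℳ a) : (N ⊔ Submodule.span S {x}).IsHomogeneous ℳ := by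
  intro n y hy
  obtain ⟨s, hs⟩ := exists_of_mem_sup_span hN (n := n) hy
  rw [← sub_add_cancel (DirectSum.decompose ℳ y n : M) (DirectSum.decompose ℳ (s • x) n : M)]
  refine add_mem (Submodule.mem_sup_left hs) (Submodule.mem_sup_right ?_)
  rcases lt_or_ge n a with h | h
  · rw [decompose_smul_of_lt ℳ 𝒮 hx s h]
    exact zero_mem _
  · obtain ⟨i, rfl⟩ := Nat.exists_eq_add_of_le' h
    rw [decompose_smul_add ℳ 𝒮 hx]
    exact Submodule.smul_mem _ _ (Submodule.mem_span_singleton_self x)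

theorem isHomogeneous_colon_singleton (𝒮 : ℕ → Submodule K S) [GradedAlgebra 𝒮]
    [SetLike.GradedSMul 𝒮 ℳ] {N : Submodule S M} (hN : N.IsHomogeneous ℳ) {a : ℕ} {x : M}
    (hx : x ∈ ℳ a) : (N.colon {x}).IsHomogeneous 𝒮 := by
  intro i s hs
  rw [Submodule.mem_colon_singleton] at hs ⊢
  rw [← decompose_smul_add ℳ 𝒮 hx]
  exact hN (i + a) hs

/-- An ideal maximal among the colons of homogeneous elements outside `N` is prime. It is
homogeneous, so homogeneous factors suffice: if `t • x ∉ N`, maximality gives `(N : x) = (N : t •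
x)`, and `s * t ∈ (N : x)` yields `s ∈ (N : x)`. -/
theorem exists_colon_isPrime (𝒮 : ℕ → Submodule K S) [GradedAlgebra 𝒮]
    [SetLike.GradedSMul 𝒮 ℳ] [IsNoetherianRing S] {N : Submodule S M} (hN : N.IsHomogeneous ℳ)
    (hNtop : N ≠ ⊤) : ∃ (a : ℕ) (x : M), x ∈ ℳ a ∧ x ∉ N ∧ (N.colon {x}).IsPrime := by
  set T : Set (Ideal S) := {I | ∃ (a : ℕ) (x : M), x ∈ ℳ a ∧ x ∉ N ∧ N.colon {x} = I} with hT
  have hne : T.Nonempty := by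
    obtain ⟨y, hy⟩ : ∃ y, y ∉ N := by
      by_contra! h
      exact hNtop (eq_top_iff.mpr fun y _ => h y)
    rw [Submodule.IsHomogeneous.mem_iff ℳ hN] at hy
    push Not at hy
    obtain ⟨a, ha⟩ := hy
    exact ⟨_, a, _, (DirectSum.decompose ℳ y a).2, ha, rfl⟩
  obtain ⟨I, ⟨a, x, hx, hxN, rfl⟩, hmax⟩ := set_has_maximal_iff_noetherian.mpr
    (inferInstance : IsNoetherian S S) T hne
  refine ⟨a, x, hx, hxN, ?_⟩
  refine Ideal.IsHomogeneous.isPrime_of_homogeneous_mem_or_mem (𝒜 := 𝒮)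
    (isHomogeneous_colon_singleton 𝒮 hN hx) ?_ ?_
  · rw [Ne, Ideal.eq_top_iff_one, Submodule.mem_colon_singleton, one_smul]
    exact hxN
  · rintro s t - ⟨j, ht⟩ hst
    rw [or_iff_not_imp_right]
    intro htx
    rw [Submodule.mem_colon_singleton] at htx
    have hle : N.colon {x} ≤ N.colon {t • x} := by
      intro r hr
      rw [Submodule.mem_colon_singleton] at hr ⊢
      rw [smul_comm]
      exact N.smul_mem t hr
    have heq : N.colon {x} = N.colon {t • x} := by
      by_contra hne
      exact hmax _ ⟨j + a, t • x, smul_mem_add ℳ 𝒮 ht hx, htx, rfl⟩ (lt_of_le_of_ne hle hne)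
    rw [heq, Submodule.mem_colon_singleton, ← mul_smul]
    exact Submodule.mem_colon_singleton.mp hst

/-! ### Lengths of the graded pieces of a quotient -/

variable [IsScalarTower K S M]

variable (ℳ) in
/-- The degree `n` part of the quotient of a graded module by a homogeneous submodule. -/
abbrev QuotientPiece (N : Submodule S M) (n : ℕ) : Type _ :=
  ℳ n ⧸ (N.restrictScalars K).comap (ℳ n).subtype

/-- Degree `n + a` of the exact sequence `0 → (S/(N : x))(-a) → M/N → M/(N + Sx) → 0`, whose first
map is multiplication by `x`. -/
theorem length_quotientPiece_add (𝒮 : ℕ → Submodule K S) [GradedAlgebra 𝒮]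
    [SetLike.GradedSMul 𝒮 ℳ] {N : Submodule S M} (hN : N.IsHomogeneous ℳ) {a : ℕ} {x : M}
    (hx : x ∈ ℳ a) (n : ℕ) :
    Module.length K (QuotientPiece ℳ N (n + a)) =
      Module.length K (QuotientPiece 𝒮 (N.colon {x} : Ideal S) n) +
        Module.length K (QuotientPiece ℳ (N ⊔ Submodule.span S {x}) (n + a)) := by
  let μ : 𝒮 n →ₗ[K] ℳ (n + a) :=
    { toFun := fun s => ⟨(s : S) • x, smul_mem_add ℳ 𝒮 s.2 hx⟩
      map_add' := fun s t => Subtype.ext (add_smul _ _ _)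
      map_smul' := fun c s => Subtype.ext (smul_assoc _ _ _) }
  have hμ : ∀ s, (μ s : M) = (s : S) • x := fun _ => rfl
  have hle : (N.restrictScalars K).comap (ℳ (n + a)).subtype ≤
      ((N ⊔ Submodule.span S {x}).restrictScalars K).comap (ℳ (n + a)).subtype :=
    Submodule.comap_mono fun y hy => Submodule.mem_sup_left hy
  let f : QuotientPiece 𝒮 (N.colon {x} : Ideal S) n →ₗ[K] QuotientPiece ℳ N (n + a) :=
    Submodule.mapQ _ _ μ fun s hs => by
      simpa [Submodule.mem_colon_singleton, hμ] using hs
  let g : QuotientPiece ℳ N (n + a) →ₗ[K] QuotientPiece ℳ (N ⊔ Submodule.span S {x}) (n + a) :=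
    Submodule.factor hle
  refine Module.length_eq_add_of_exact f g ?_ ?_ ?_
  · rw [← LinearMap.ker_eq_bot, LinearMap.ker_eq_bot']
    intro q hq
    obtain ⟨s, rfl⟩ := Submodule.Quotient.mk_surjective _ q
    rw [Submodule.mapQ_apply, Submodule.Quotient.mk_eq_zero] at hq
    rw [Submodule.Quotient.mk_eq_zero]
    simpa [Submodule.mem_colon_singleton, hμ] using hq
  · exact Submodule.factor_surjective _
  · intro q
    obtain ⟨y, rfl⟩ := Submodule.Quotient.mk_surjective _ q
    constructor
    · intro hq
      have hy : (y : M) ∈ N ⊔ Submodule.span S {x} := by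
        rw [← Submodule.mkQ_apply, Submodule.factor_mk, Submodule.mkQ_apply,
          Submodule.Quotient.mk_eq_zero] at hq
        exact hq
      obtain ⟨s, hs⟩ := exists_of_mem_sup_span hN (n := n + a) hy
      rw [decompose_smul_add ℳ 𝒮 hx, DirectSum.decompose_of_mem_same ℳ y.2] at hs
      refine ⟨Submodule.Quotient.mk (DirectSum.decompose 𝒮 s n), ?_⟩
      rw [Submodule.mapQ_apply, eq_comm, Submodule.Quotient.eq]
      exact hs
    · rintro ⟨q', hq'⟩
      obtain ⟨s, rfl⟩ := Submodule.Quotient.mk_surjective _ q'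
      rw [← hq', Submodule.mapQ_apply]
      have : (s : S) • x ∈ N ⊔ Submodule.span S {x} := Submodule.mem_sup_right
        (Submodule.smul_mem _ _ (Submodule.mem_span_singleton_self x))
      rw [← Submodule.mkQ_apply, Submodule.factor_mk, Submodule.mkQ_apply,
        Submodule.Quotient.mk_eq_zero]
      exact this

theorem length_quotientPiece_of_lt (𝒮 : ℕ → Submodule K S) [GradedAlgebra 𝒮]
    [SetLike.GradedSMul 𝒮 ℳ] {N : Submodule S M} (hN : N.IsHomogeneous ℳ) {a n : ℕ} {x : M}
    (hx : x ∈ ℳ a) (hn : n < a) :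
    Module.length K (QuotientPiece ℳ N n) =
      Module.length K (QuotientPiece ℳ (N ⊔ Submodule.span S {x}) n) := by
  have : (N.restrictScalars K).comap (ℳ n).subtype =
      ((N ⊔ Submodule.span S {x}).restrictScalars K).comap (ℳ n).subtype := by
    refine le_antisymm (Submodule.comap_mono fun y hy => Submodule.mem_sup_left hy) fun y hy => ?_
    obtain ⟨s, hs⟩ := exists_of_mem_sup_span hN (n := n) hy
    rw [decompose_smul_of_lt ℳ 𝒮 hx s hn, Submodule.subtype_apply,
      DirectSum.decompose_of_mem_same ℳ y.2, sub_zero] at hs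
    exact hs
  exact (Submodule.quotEquivOfEq _ _ this).length_eq

variable (ℳ) in
/-- The graded pieces of `M / N` have finite length, and their lengths agree eventually with a
polynomial of degree less than `d`. -/
def HilbertDegreeLT (d : ℕ) (N : Submodule S M) : Prop :=
  ∃ f : ℕ → ℕ, (∀ n, Module.length K (QuotientPiece ℳ N n) = f n) ∧
    EventuallyPolyLT d fun n => (f n : ℚ)

theorem HilbertDegreeLT.of_colon (𝒮 : ℕ → Submodule K S) [GradedAlgebra 𝒮]
    [SetLike.GradedSMul 𝒮 ℳ] {d : ℕ} {N : Submodule S M} (hN : N.IsHomogeneous ℳ) {a : ℕ}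
    {x : M} (hx : x ∈ ℳ a) (h1 : HilbertDegreeLT 𝒮 d (N.colon {x} : Ideal S))
    (h2 : HilbertDegreeLT ℳ d (N ⊔ Submodule.span S {x})) : HilbertDegreeLT ℳ d N := by
  obtain ⟨f, hf, hfd⟩ := h1
  obtain ⟨g, hg, hgd⟩ := h2
  refine ⟨fun n => (if a ≤ n then f (n - a) else 0) + g n, fun n => ?_, ?_⟩
  · dsimp only
    split_ifs with hn
    · obtain ⟨k, rfl⟩ := Nat.exists_eq_add_of_le' hn
      rw [length_quotientPiece_add 𝒮 hN hx, hf, hg, Nat.add_sub_cancel, Nat.cast_add]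
    · rw [length_quotientPiece_of_lt 𝒮 hN hx (not_le.mp hn), hg, zero_add]
  · rw [← EventuallyPolyLT.comp_add_iff a] at hgd ⊢
    simpa using! hfd.add hgd

theorem HilbertDegreeLT.top (d : ℕ) : HilbertDegreeLT ℳ d (⊤ : Submodule S M) := by
  refine ⟨fun _ => 0, fun n => ?_, by simpa using EventuallyPolyLT.zero d⟩
  rw [Nat.cast_zero, Module.length_eq_zero_iff, Submodule.Quotient.subsingleton_iff]
  exact eq_top_iff.mpr fun y _ => (Submodule.mem_top : (y : M) ∈ (⊤ : Submodule S M))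

/-- Dévissage: it suffices to treat the quotients of `S` by homogeneous primes. -/
theorem HilbertDegreeLT.of_forall_isPrime (𝒮 : ℕ → Submodule K S) [GradedAlgebra 𝒮]
    [SetLike.GradedSMul 𝒮 ℳ] [IsNoetherianRing S] [Module.Finite S M] {d : ℕ}
    {N : Submodule S M} (hN : N.IsHomogeneous ℳ)
    (h : ∀ p : Ideal S, p.IsPrime → p.IsHomogeneous 𝒮 → (∃ x, N.colon {x} ≤ p) →
      HilbertDegreeLT 𝒮 d p) : HilbertDegreeLT ℳ d N := by
  induction N using WellFoundedGT.induction with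
  | ind N ih =>
    by_cases hNtop : N = ⊤
    · rw [hNtop]
      exact .top d
    · obtain ⟨a, x, hx, hxN, hp⟩ := exists_colon_isPrime 𝒮 hN hNtop
      refine .of_colon 𝒮 hN hx
        (h _ hp (isHomogeneous_colon_singleton 𝒮 hN hx) ⟨x, le_rfl⟩)
        (ih _ ?_ (isHomogeneous_sup_span 𝒮 hN hx) ?_)
      · refine lt_of_le_of_ne le_sup_left fun heq => hxN ?_
        rw [heq]
        exact Submodule.mem_sup_right (Submodule.mem_span_singleton_self x)
      -- Colons grow with the submodule, so the primes relevant to `N + Sx` are already relevant to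
      -- `N`.
      · rintro p hp hph ⟨y, hy⟩
        refine h p hp hph ⟨y, le_trans (fun s hs => ?_) hy⟩
        rw [Submodule.mem_colon_singleton] at hs ⊢
        exact Submodule.mem_sup_left hs

end Graded

/-! ### Quotients by homogeneous primes -/

section Prime

variable {K S : Type*} [Field K] [CommRing S] [Algebra K S] {𝒮 : ℕ → Submodule K S}
  [GradedAlgebra 𝒮]

/-- The generators vanish modulo `p`, so every element is a scalar modulo `p`. For `s` of degree `n
≠ 0`, the degree `n` component of `s - c` is `s`. -/
theorem IsStandardGraded.le_of_degree_one_le (hS : IsStandardGraded 𝒮) {p : Ideal S}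
    (hp : p.IsHomogeneous 𝒮) (h1 : ∀ x ∈ 𝒮 1, x ∈ p) {n : ℕ} (hn : n ≠ 0) {s : S} (hs : s ∈ 𝒮 n) :
    s ∈ p := by
  have hmem : ∀ t : S, ∃ c : K, t - algebraMap K S c ∈ p := by
    intro t
    have ht : t ∈ Algebra.adjoin K (𝒮 1 : Set S) := hS.generated ▸ Algebra.mem_top
    induction ht using Algebra.adjoin_induction with
    | mem x hx => exact ⟨0, by simpa using h1 x hx⟩
    | algebraMap c => exact ⟨c, by simp⟩
    | add x y _ _ hx hy =>
      obtain ⟨c, hc⟩ := hx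
      obtain ⟨e, he⟩ := hy
      refine ⟨c + e, ?_⟩
      have := add_mem hc he
      rwa [map_add, add_sub_add_comm]
    | mul x y _ _ hx hy =>
      obtain ⟨c, hc⟩ := hx
      obtain ⟨e, he⟩ := hy
      refine ⟨c * e, ?_⟩
      have := add_mem (p.mul_mem_right y hc) (p.mul_mem_left (algebraMap K S c) he)
      rw [map_mul]
      convert! this using 1
      ring
  obtain ⟨c, hc⟩ := hmem s
  have h0 : algebraMap K S c ∈ 𝒮 0 := by
    rw [hS.degree_zero]
    exact ⟨c, rfl⟩
  have := hp n hc
  rwa [DirectSum.decompose_sub, DFinsupp.sub_apply, Submodule.coe_sub,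
    DirectSum.decompose_of_mem_same 𝒮 hs, DirectSum.decompose_of_mem_ne 𝒮 h0 hn.symm,
    sub_zero] at this

theorem IsStandardGraded.length_quotientPiece_zero_ne_top (hS : IsStandardGraded 𝒮)
    (p : Ideal S) : Module.length K (QuotientPiece 𝒮 p 0) ≠ ⊤ := by
  have : Module.Finite K (𝒮 0) := by
    rw [hS.degree_zero]
    infer_instance
  exact Module.length_ne_top

theorem HilbertDegreeLT.of_degree_one_le (hS : IsStandardGraded 𝒮) {p : Ideal S}
    (hp : p.IsHomogeneous 𝒮) (h1 : ∀ x ∈ 𝒮 1, x ∈ p) (d : ℕ) : HilbertDegreeLT 𝒮 d p := by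
  refine ⟨fun n => if n = 0 then (Module.length K (QuotientPiece 𝒮 p 0)).toNat else 0,
    fun n => ?_, (EventuallyPolyLT.zero d).congr ?_⟩
  · dsimp only
    split_ifs with hn
    · rw [hn, ENat.natCast_toNat (hS.length_quotientPiece_zero_ne_top p)]
    · rw [Nat.cast_zero, Module.length_eq_zero_iff, Submodule.Quotient.subsingleton_iff]
      exact eq_top_iff.mpr fun y _ => hS.le_of_degree_one_le hp h1 hn y.2
  · filter_upwards [eventually_ne_atTop 0] with n hn
    rw [if_neg hn, Nat.cast_zero]

/-- Since `p` is prime and `x ∉ p`, `(p : x) = p`, and the exact sequence for `x` computes the first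
difference. It also carries finite length upwards from degree `0`. -/
theorem HilbertDegreeLT.succ_of_isPrime (hS : IsStandardGraded 𝒮) {p : Ideal S} [p.IsPrime]
    (hp : p.IsHomogeneous 𝒮) {x : S} (hx : x ∈ 𝒮 1) (hxp : x ∉ p) {d : ℕ}
    (h : HilbertDegreeLT 𝒮 d (p ⊔ Ideal.span {x})) : HilbertDegreeLT 𝒮 (d + 1) p := by
  obtain ⟨g, hg, hgd⟩ := h
  have hcolon : Submodule.colon p {x} = p := by
    ext s
    rw [Submodule.mem_colon_singleton, smul_eq_mul]
    exact ⟨fun h => (Ideal.IsPrime.mem_or_mem ‹_› h).resolve_right hxp, p.mul_mem_right x⟩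
  have hlen : ∀ n, Module.length K (QuotientPiece 𝒮 p (n + 1)) =
      Module.length K (QuotientPiece 𝒮 p n) + g (n + 1) := by
    intro n
    have := length_quotientPiece_add 𝒮 hp hx n
    rw [hcolon] at this
    rw [this, ← hg]
  have hfin : ∀ n, Module.length K (QuotientPiece 𝒮 p n) ≠ ⊤ := by
    intro n
    induction n with
    | zero => exact hS.length_quotientPiece_zero_ne_top p
    | succ n ih =>
      rw [hlen]
      exact WithTop.add_ne_top.mpr ⟨ih, ENat.natCast_ne_top _⟩
  refine ⟨fun n => (Module.length K (QuotientPiece 𝒮 p n)).toNat,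
    fun n => (ENat.natCast_toNat (hfin n)).symm, .succ ?_⟩
  rw [← EventuallyPolyLT.comp_add_iff 1] at hgd
  convert! hgd using 2 with n
  dsimp only
  rw [hlen, ENat.toNat_add (hfin n) (ENat.natCast_ne_top _), ENat.toNat_natCast, Nat.cast_add,
    add_sub_cancel_left]

/-- Multiples of `x` have no degree zero component, so `1 ∈ p + (x)` would force `1 ∈ p`. -/
theorem Ideal.sup_span_ne_top_of_mem_degree_one {p : Ideal S} (hp : p.IsHomogeneous 𝒮)
    (hptop : p ≠ ⊤) {x : S} (hx : x ∈ 𝒮 1) : p ⊔ Ideal.span {x} ≠ ⊤ := by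
  rw [Ne, Ideal.eq_top_iff_one] at hptop ⊢
  intro h
  obtain ⟨s, hs⟩ := exists_of_mem_sup_span (N := p) hp (n := 0) h
  rw [decompose_smul_of_lt 𝒮 𝒮 hx s Nat.zero_lt_one,
    DirectSum.decompose_of_mem_same 𝒮 SetLike.GradedOne.one_mem, sub_zero] at hs
  exact hptop hs

/-- In coheight `0` a degree one `x ∉ p` would give a prime strictly above `p`, so all of `𝒮 1` lies
in `p`. Otherwise cut by such an `x`: the primes met in the dévissage of `S/(p + (x))` lie strictly
above `p` and have smaller coheight. -/
theorem IsStandardGraded.hilbertDegreeLT_of_coheight_le (hS : IsStandardGraded 𝒮)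
    (d : ℕ) (p : PrimeSpectrum S) (hp : p.asIdeal.IsHomogeneous 𝒮)
    (hd : Order.coheight p ≤ (d : ℕ∞)) : HilbertDegreeLT 𝒮 d p.asIdeal := by
  have := hS.finiteType
  have : IsNoetherianRing S := Algebra.FiniteType.isNoetherianRing K S
  induction d generalizing p with
  | zero =>
    refine .of_degree_one_le hS hp (fun x hx => ?_) 0
    by_contra hxp
    obtain ⟨q, hq, hle⟩ := Ideal.exists_le_maximal _
      (Ideal.sup_span_ne_top_of_mem_degree_one hp p.2.ne_top hx)
    have hlt : p < ⟨q, hq.isPrime⟩ := by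
      refine lt_of_le_not_ge (show p.asIdeal ≤ q from le_sup_left.trans hle) fun h => hxp ?_
      exact h (hle (Submodule.mem_sup_right (Ideal.mem_span_singleton_self x)))
    exact not_lt_zero (Order.coheight_le_coe_iff.mp hd _ hlt)
  | succ d ih =>
    by_cases h1 : ∀ x ∈ 𝒮 1, x ∈ p.asIdeal
    · exact .of_degree_one_le hS hp h1 _
    push Not at h1
    obtain ⟨x, hx, hxp⟩ := h1
    refine .succ_of_isPrime hS hp hx hxp ?_
    refine .of_forall_isPrime 𝒮 (isHomogeneous_sup_span 𝒮 hp hx) fun q hq hqh ⟨y, hy⟩ => ?_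
    have hle : p.asIdeal ⊔ Ideal.span {x} ≤ q := fun s hs =>
      hy (Submodule.mem_colon_singleton.mpr (Ideal.mul_mem_right y _ hs))
    have hlt : p < ⟨q, hq⟩ := by
      refine lt_of_le_not_ge (show p.asIdeal ≤ q from le_sup_left.trans hle) fun h => hxp ?_
      exact h (hle (Submodule.mem_sup_right (Ideal.mem_span_singleton_self x)))
    refine ih ⟨q, hq⟩ hqh ?_
    exact ENat.lt_natCast_add_one_iff.mp (by exact_mod_cast Order.coheight_le_coe_iff.mp hd _ hlt)

end Prime

/-! ### Hilbert functions of graded modules -/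

section Hilbert

variable {K S M : Type*} [Field K] [CommRing S] [Algebra K S]
  [AddCommGroup M] [Module K M] [Module S M] [IsScalarTower K S M]
  {𝒮 : ℕ → Submodule K S} [GradedAlgebra 𝒮]
  {ℳ : ℕ → Submodule K M} [DirectSum.Decomposition ℳ] [SetLike.GradedSMul 𝒮 ℳ]

/-- Supports are closed upwards, so chains of primes starting at `p` stay inside. -/
theorem coheight_le_supportDim {p : PrimeSpectrum S} (hp : p ∈ Module.support S M) :
    ((Order.coheight p : ℕ∞) : WithBot ℕ∞) ≤ Module.supportDim S M := by
  rw [Order.coheight_eq_krullDim_Ici]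
  exact Order.krullDim_le_of_strictMono
    (fun q : Set.Ici p => (⟨q.1, Module.mem_support_mono q.2 hp⟩ : Module.support S M))
    fun _ _ h => h

theorem eventuallyPolyLT_hilbertFunction (hS : IsStandardGraded 𝒮) [Module.Finite S M] {m : ℕ}
    (hm : Module.supportDim S M = (m : WithBot ℕ∞)) :
    EventuallyPolyLT m fun n => (hilbertFunction ℳ n : ℚ) := by
  have := hS.finiteType
  have : IsNoetherianRing S := Algebra.FiniteType.isNoetherianRing K S
  have hbot : (⊥ : Submodule S M).IsHomogeneous ℳ := by
    intro n y hy
    rw [(Submodule.mem_bot S).mp hy, DirectSum.decompose_zero]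
    exact zero_mem _
  have key : HilbertDegreeLT ℳ m (⊥ : Submodule S M) := by
    refine .of_forall_isPrime 𝒮 hbot fun p hp hph ⟨x, hx⟩ => ?_
    refine hS.hilbertDegreeLT_of_coheight_le m ⟨p, hp⟩ hph ?_
    have hsupp : (⟨p, hp⟩ : PrimeSpectrum S) ∈ Module.support S M := by
      refine Module.mem_support_iff_exists_annihilator.mpr ⟨x, fun s hs => hx ?_⟩
      rw [Submodule.mem_colon_singleton, Submodule.mem_bot]
      exact (Submodule.mem_annihilator_span_singleton _ _).mp hs
    have h := coheight_le_supportDim hsupp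
    rw [hm] at h
    exact_mod_cast h
  obtain ⟨f, hf, hfd⟩ := key
  convert! hfd using 2 with n
  have hq : ((⊥ : Submodule S M).restrictScalars K).comap (ℳ n).subtype = ⊥ := by
    ext y
    simp
  have hlen := hf n
  rw [(Submodule.quotEquivOfEqBot _ hq).length_eq] at hlen
  -- Finite length makes `finrank` the true dimension and not the default value `0`.
  have : Module.Finite K (ℳ n) := by
    have h : IsFiniteLength K (ℳ n) :=
      Module.length_ne_top_iff.mp (hlen ▸ ENat.natCast_ne_top _)
    have := (isFiniteLength_iff_isNoetherian_isArtinian.mp h).1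
    infer_instance
  rw [Module.length_eq_finrank] at hlen
  exact_mod_cast hlen

theorem eventuallyPolyLT_iteratedHilbert {m : ℕ}
    (h : EventuallyPolyLT m fun n => (hilbertFunction ℳ n : ℚ)) (i : ℕ) :
    EventuallyPolyLT (m + i) fun n => (iteratedHilbert ℳ i n : ℚ) := by
  induction i with
  | zero => exact h
  | succ i ih =>
    refine .succ ?_
    -- The difference of `H_{i+1}` at `n` is `H_i` at `n + 1`, hence the shift.
    rw [← EventuallyPolyLT.comp_add_iff 1] at ih
    convert! ih using 2 with n
    simp [iteratedHilbert, Finset.sum_range_succ _ (n + 1)]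

end Hilbert

end

theorem proposition3p4 {K S M : Type*} [Field K] [CommRing S] [Algebra K S]
    [AddCommGroup M] [Module K M] [Module S M] [IsScalarTower K S M]
    (𝒮 : ℕ → Submodule K S) [GradedAlgebra 𝒮] (hS : IsStandardGraded 𝒮)
    (ℳ : ℕ → Submodule K M) [DirectSum.Decomposition ℳ] [SetLike.GradedSMul 𝒮 ℳ]
    [Module.Finite S M]
    (m : ℕ) (hm : Module.supportDim S M = (m : WithBot ℕ∞)) (i : ℕ) :
    -- `P_i(M, n)` exists, has degree at most `m + i - 1`, and equals `H_i(M, n)` from `α^i(M)` on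
    ((hilbertPolynomial ℳ i).degree < ((m + i : ℕ) : WithBot ℕ) ∧
      ∀ n : ℕ, hilbertAlpha ℳ i ≤ n →
        (iteratedHilbert ℳ i n : ℚ) = (hilbertPolynomial ℳ i).eval (n : ℚ)) ∧
    -- the function `ζ^i_M(z, w)`
    (∀ w : ℝ, 0 < w →
      (∀ z : ℂ, ((m + i : ℕ) : ℝ) < z.re →
        HasSum (fun n : ℕ => (iteratedHilbert ℳ i n : ℂ) / ((n : ℂ) + (w : ℂ)) ^ z)
          (higherZetaBarnes ℳ i w z)) ∧
      (∀ z : ℂ, z ∉ onePoleSet (m + i) →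
        higherZetaBarnes ℳ i w z = higherThetaBarnes ℳ i w z +
          ∑ k ∈ Finset.range (m + i), hilbertCoeff ℳ i k *
            ∑ l ∈ Finset.range (k + 1), (k.choose l : ℂ) * (-(w : ℂ)) ^ l *
              hurwitz (z - (k : ℂ) + (l : ℂ)) ((hilbertAlpha ℳ i : ℝ) + w)) ∧
      Meromorphic (higherZetaBarnes ℳ i w) ∧
      (∀ z : ℂ, z ∉ onePoleSet (m + i) → AnalyticAt ℂ (higherZetaBarnes ℳ i w) z) ∧
      ∀ k : ℕ, k < m + i →
        HasAtMostSimplePole (higherZetaBarnes ℳ i w) ((k : ℂ) + 1)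
          (∑ l ∈ Finset.Ico k (m + i),
            (l.choose k : ℂ) * (-(w : ℂ)) ^ (l - k) * hilbertCoeff ℳ i l)) ∧
    -- the function `ζ^i_M(z)`
    ((∀ z : ℂ, z ∉ onePoleSet (m + i) →
        Tendsto (fun w : ℝ =>
            higherZetaBarnes ℳ i w z - (hilbertFunction ℳ 0 : ℂ) * (w : ℂ) ^ (-z))
          (𝓝[>] (0 : ℝ)) (𝓝 (higherZeta ℳ i z))) ∧
      (∀ z : ℂ, z ∉ onePoleSet (m + i) →
        higherZeta ℳ i z = higherTheta ℳ i z +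
          ∑ k ∈ Finset.range (m + i), hilbertCoeff ℳ i k *
            hurwitz (z - (k : ℂ)) ((max (hilbertAlpha ℳ i) 1 : ℕ) : ℝ)) ∧
      Meromorphic (higherZeta ℳ i) ∧
      (∀ z : ℂ, z ∉ onePoleSet (m + i) → AnalyticAt ℂ (higherZeta ℳ i) z) ∧
      ∀ k : ℕ, k < m + i →
        HasAtMostSimplePole (higherZeta ℳ i) ((k : ℂ) + 1) (hilbertCoeff ℳ i k)) := by
  obtain ⟨P, hdeg, hP⟩ := (eventuallyPolyLT_iteratedHilbert (ℳ := ℳ)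
    (eventuallyPolyLT_hilbertFunction hS hm) i).exists_polynomial
  exact higherZeta_of_eventually_eq_eval hP hdeg
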